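/- **Setting.** Let $d\ge 0$, let $\mathcal S,\mathcal A$ be arbitrary sets and let $\Xi=\mathcal S\times\mathcal A\times\mathcal S$ be the set of state-action-state triples. Let $\Theta,\Omega\subseteq\mathbb R^d$ be closed convex sets and $f(\theta,\omega;\xi)$ a real function of $\theta,\omega\in\mathbb R^d$, $\xi\in\Xi$. Let $D\subseteq\mathbb R^d\times\mathbb R^d$ be a convex set with nonempty interior that contains $\Theta\times\Omega$ (for instance $D=\mathbb R^d\times\mathbb R^d$, or $D=\Theta\times\Omega$ if this has interior points). Assume that for every $\xi\in\Xi$ the function $f(\cdot,\cdot;\xi)$ is differentiable at every point of $D$ and is $G$-Lipschitz on $D$ with respect to the Euclidean norm, i.e. $|f(\theta,\omega;\xi)-f(\theta',\omega';\xi)|\le G\,\|(\theta,\omega)-(\theta',\omega')\|$ on $D$, where $G>0$. **Algorithm (DPTD).** Fix $\kappa,\eta,\alpha,\beta>0$, step sizes $\nu_t>0$ with $\alpha\nu_t\le1$ and $\beta\nu_t\le 1$ for all $t\ge0$ (and $\nu_t\le1$ for all $t\ge 0$ unless $D=\mathbb R^d\times\mathbb R^d$), starting points $\theta_0\in\Theta$,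 $\omega_0\in\Omega$, an integer $T\ge1$ and a variance $\sigma^2$. The input is a trajectory $S\in\Xi^n$, $n\ge1$. For each $t$ a data point $\xi_t$ is drawn uniformly from the $n$ entries of $S$, and noises $u^p_t,u^d_t\sim N(0,\sigma^2 I_d)$ are drawn, all independently. With $\mathcal P$ the Euclidean projection, $p_0=\nabla_\theta f(\theta_0,\omega_0;\xi_0)+u_0^p$, $d_0=\nabla_\omega f(\theta_0,\omega_0;\xi_0)+u_0^d$, and for $t\ge 0$ $$\theta_{t+1}=\theta_t+\nu_t\big(\mathcal P_\Theta(\theta_t-\kappa p_t)-\theta_t\big),\qquad \omega_{t+1}=\omega_t+\nu_t\big(\mathcal P_\Omega(\omega_t+\eta d_t)-\omega_t\big),$$ $$p_{t+1}=(1-\alpha\nu_t)p_t+\alpha\nu_t\nabla_\theta f(\theta_{t+1},\omega_{t+1};\xi_{t+1})+u^p_{t+1},\qquad d_{t+1}=(1-\beta\nu_t)d_t+\beta\nu_t\nabla_\omega f(\theta_{t+1},\omega_{t+1};\xi_{t+1})+u^d_{t+1}.$$ The gradient estimators $(p_t,d_t)_{0\le t<T}$ are released, and the output is $(\bar\theta,\bar\omega)$,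 chosen uniformly at random (independently of everything else) from $\{(\theta_t,\omega_t)\}_{t=0}^{T-1}$. **Privacy notion.** Two trajectories in $\Xi^n$ are neighbouring if they differ at exactly one index. A randomized mechanism $\mathcal M$ on $\Xi^n$ is $(\epsilon,\delta)$-DP under state-action-state if $\mathbb P(\mathcal M(S)\in Y)\le e^{\epsilon}\,\mathbb P(\mathcal M(\hat S)\in Y)+\delta$ for all neighbouring $S,\hat S$ and all measurable sets $Y$ of outputs. **Theorem.** Let $\epsilon>0$, $\delta>0$, $\beta'\in(0,1)$, and put $$\alpha'=\frac{\log(1/\delta)}{(1-\beta')\epsilon}+1,\qquad \sigma^2=\frac{14G^2T\alpha'}{n^2\beta'\epsilon},\qquad \sigma'^2=\frac{\sigma^2}{4G^2}.$$ Suppose that $\sigma'^2\ge0.7$ and $\alpha'\le \frac23\,\sigma'^2\log\!\Big(\frac{n}{\alpha'(1+\sigma'^2)}\Big)+1$. Then the algorithm with noise variance $\sigma_t^2=\sigma^2$ for all $t\ge 0$ is $(\epsilon,\delta)$-DP under state-action-state; that is, the output $(\bar\theta,\bar\omega)$, and also the output together with all released estimators $(p_t,d_t)_{0\le t<T}$,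 is $(\epsilon,\delta)$-DP under state-action-state. Moreover, if $\delta\neq1$, then also $\sigma^2=\dfrac{14G^2T\alpha'}{n^2\big(\epsilon-\frac{\log(1/\delta)}{\alpha'-1}\big)}$. -/

import Mathlib

open MeasureTheory ProbabilityTheory

noncomputable section

/-- Two sequences of data points of the same length `n` are neighbouring if they differ at exactly
one index. -/
def Neighbouring {Ξ : Type*} {n : ℕ} (S S' : Fin n → Ξ) : Prop :=
  ∃! i, S i ≠ S' i

/-- `(ε, δ)`-differential privacy, with respect to the neighbouring relation `adj`, of the
randomized mechanism `M`. The internal randomness of the mechanism is a point `c` of the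
probability space `(C, P)`, and on input `x` the mechanism returns the random variable `M x`. -/
def IsDP {X C Y : Type*} [MeasurableSpace C] [MeasurableSpace Y] (adj : X → X → Prop)
    (P : Measure C) (M : X → C → Y) (ε δ : ℝ) : Prop :=
  (∀ x, Measurable (M x)) ∧
    ∀ x x', adj x x' → ∀ B : Set Y, MeasurableSet B →
      P (M x ⁻¹' B) ≤ ENNReal.ofReal (Real.exp ε) * P (M x' ⁻¹' B) + ENNReal.ofReal δ

/-- The Euclidean projection onto `K`: the point of `K` nearest to `x` (which exists and is unique
if `K` is a nonempty closed convex set). -/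
def euclideanProj {d : ℕ} (K : Set (EuclideanSpace ℝ (Fin d))) (x : EuclideanSpace ℝ (Fin d)) :
    EuclideanSpace ℝ (Fin d) :=
  Classical.epsilon fun y => y ∈ K ∧ ∀ z ∈ K, ‖x - y‖ ≤ ‖x - z‖

/-- The input data of the algorithm: the stochastic function `f θ ω ξ`, the feasible sets, the step
sizes and momentum parameters, and the starting point. -/
structure DPTDInput (d : ℕ) (Ξ : Type*) where
  f : EuclideanSpace ℝ (Fin d) → EuclideanSpace ℝ (Fin d) → Ξ → ℝ
  Θset : Set (EuclideanSpace ℝ (Fin d))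
  Ωset : Set (EuclideanSpace ℝ (Fin d))
  ν : ℕ → ℝ
  κ : ℝ
  η : ℝ
  α : ℝ
  β : ℝ
  θ₀ : EuclideanSpace ℝ (Fin d)
  ω₀ : EuclideanSpace ℝ (Fin d)

namespace DPTDInput

variable {d : ℕ} {Ξ : Type*}

/-- The partial gradient of `f` in the primal variable. -/
def gradθ (A : DPTDInput d Ξ) (θ ω : EuclideanSpace ℝ (Fin d)) (ξ : Ξ) :
    EuclideanSpace ℝ (Fin d) :=
  gradient (fun x => A.f x ω ξ) θ

/-- The partial gradient of `f` in the dual variable. -/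
def gradω (A : DPTDInput d Ξ) (θ ω : EuclideanSpace ℝ (Fin d)) (ξ : Ξ) :
    EuclideanSpace ℝ (Fin d) :=
  gradient (fun y => A.f θ y ξ) ω

end DPTDInput

/-- The quantities `θ_t`, `ω_t`, `p_t`, `d_t` held by the algorithm at time `t`
(`p` and `q` are the released noisy gradient estimators on the primal and on the dual side). -/
structure DPTDState (d : ℕ) where
  θ : EuclideanSpace ℝ (Fin d)
  ω : EuclideanSpace ℝ (Fin d)
  p : EuclideanSpace ℝ (Fin d)
  q : EuclideanSpace ℝ (Fin d)

/-- The iteration of the algorithm, when `ξ t` is the data point sampled at time `t` and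
`u t`, `v t` are the noises added at time `t` on the primal and on the dual side. -/
def dptdState {d : ℕ} {Ξ : Type*} (A : DPTDInput d Ξ) (ξ : ℕ → Ξ)
    (u v : ℕ → EuclideanSpace ℝ (Fin d)) : ℕ → DPTDState d
  | 0 =>
    { θ := A.θ₀
      ω := A.ω₀
      p := A.gradθ A.θ₀ A.ω₀ (ξ 0) + u 0
      q := A.gradω A.θ₀ A.ω₀ (ξ 0) + v 0 }
  | t + 1 =>
    let s := dptdState A ξ u v t
    let θ' := s.θ + A.ν t • (euclideanProj A.Θset (s.θ - A.κ • s.p) - s.θ)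
    let ω' := s.ω + A.ν t • (euclideanProj A.Ωset (s.ω + A.η • s.q) - s.ω)
    { θ := θ'
      ω := ω'
      p := (1 - A.α * A.ν t) • s.p + (A.α * A.ν t) • A.gradθ θ' ω' (ξ (t + 1)) + u (t + 1)
      q := (1 - A.β * A.ν t) • s.q + (A.β * A.ν t) • A.gradω θ' ω' (ξ (t + 1)) + v (t + 1) }

/-- The internal randomness of the algorithm: for each time `t` the index in `{1, …, n}` of the
sampled data point, the primal noise and the dual noise; and the time in `{0, …, T - 1}` of the
iterate that is output. -/
abbrev DPTDCoins (d n T : ℕ) : Type :=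
  (ℕ → Fin n × EuclideanSpace ℝ (Fin d) × EuclideanSpace ℝ (Fin d)) × Fin T

/-- The centred Gaussian distribution `N(0, σsq I_d)`. -/
def isotropicGaussian (d : ℕ) (σsq : ℝ) : Measure (EuclideanSpace ℝ (Fin d)) :=
  (stdGaussian (EuclideanSpace ℝ (Fin d))).map fun x => √σsq • x

/-- The law of the internal randomness: everything is independent, indices and output time are
uniformly distributed, and all noises are distributed according to `N(0, σsq I_d)`. -/
def dptdCoinLaw (d n T : ℕ) (σsq : ℝ) : Measure (DPTDCoins d n T) :=
  (Measure.infinitePi fun _ : ℕ =>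
    (uniformOn (Set.univ : Set (Fin n))).prod
      ((isotropicGaussian d σsq).prod (isotropicGaussian d σsq))).prod
    (uniformOn (Set.univ : Set (Fin T)))

/-- The state at time `t` of the algorithm run on the data set `S` with internal randomness `c`. -/
def dptdRun {d n T : ℕ} {Ξ : Type*} (A : DPTDInput d Ξ) (S : Fin n → Ξ) (c : DPTDCoins d n T)
    (t : ℕ) : DPTDState d :=
  dptdState A (fun s => S (c.1 s).1) (fun s => (c.1 s).2.1) (fun s => (c.1 s).2.2) t

/-- The output of the algorithm: an iterate `(θ_t, ω_t)`, `0 ≤ t < T`, chosen uniformly. -/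
def dptdOutput {d n T : ℕ} {Ξ : Type*} (A : DPTDInput d Ξ) (S : Fin n → Ξ)
    (c : DPTDCoins d n T) : EuclideanSpace ℝ (Fin d) × EuclideanSpace ℝ (Fin d) :=
  ((dptdRun A S c c.2).θ, (dptdRun A S c c.2).ω)

/-- The released gradient estimators `(p_t, d_t)`, `0 ≤ t < T`. -/
def dptdReleases {d n T : ℕ} {Ξ : Type*} (A : DPTDInput d Ξ) (S : Fin n → Ξ)
    (c : DPTDCoins d n T) :
    Fin T → EuclideanSpace ℝ (Fin d) × EuclideanSpace ℝ (Fin d) :=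
  fun t => ((dptdRun A S c t).p, (dptdRun A S c t).q)

end

/-! The iterates depend on the data only through the released estimators. With the history of
releases fixed, one iteration therefore draws from a uniform mixture of `n` Gaussians of variance
`σsq`, one for each index that may be sampled. Gradients have Euclidean norm at most `G`, so any two
centres, of the same or of different mixtures, are at distance at most `2G`; neighbouring
trajectories change a single centre. What has to be bounded is the Rényi divergence of order `α'`
between two such mixtures, composed `T` times.

One step is `lintegral_mixture_rpow_le`. Let `s = 4G²/σsq` and `q = 1/n`, and take densities
relative to a standard Gaussian. The mixtures satisfy `P = Q + q(a - b)`, and a second-order Taylor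
bound for `(P/Q)^α` estimates `P^α Q^(1-α)` by `Q`, a linear term of integral zero, and `q²` times
products of powers of `a`, `b` and negative powers of `Q`. Jensen (`mean_rpow_neg_le`) replaces the
latter by the components of `Q`, which leaves explicit Gaussian integrals. `exists_renyiCoeffBound`
chooses the coefficients so that these sum to at most `3.5 s`; the upper bound on `α'` is what keeps
the terms beyond second order small enough.

For composition, a Rényi bound is expressed by Hölder duality (`RenyiDual`) as an inequality over
all test functions. Such inequalities chain by Fubini alone (`RenyiDual.comp`), with no densities or
conditional laws on the space of histories. After `T` steps the divergence is at most `3.5 T α s /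
n²`, and `RenyiDual.measure_le` adds `log(1/δ)/(α-1)`. The prescribed variance makes these summands
`β'ε` and `(1-β')ε`.

Since `D` need not be open, gradients at boundary points are reached through
`exists_tendsto_fderiv`, which gives both their norm bound and their measurability. -/

noncomputable section

/-! ### Elementary inequalities for real powers -/

/-- Bernoulli's inequality for the exponent `α - 1 ≤ 1`, multiplied by `y`. -/
lemma rpow_le_quadratic_of_le_two {y α : ℝ} (hy : 0 ≤ y) (h1 : 1 < α) (h2 : α ≤ 2) :
    y ^ α ≤ 1 + α * (y - 1) + (α - 1) * (y - 1) ^ 2 := by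
  have h := rpow_one_add_le_one_add_mul_self (s := y - 1) (by linarith) (p := α - 1)
    (by linarith) (by linarith)
  rw [add_sub_cancel] at h
  have e : y ^ α = y * y ^ (α - 1) := by
    rcases hy.eq_or_lt with rfl | hy
    · rw [Real.zero_rpow (by linarith)]; ring
    · rw [← Real.rpow_one_add' hy.le (by linarith)]; ring_nf
  rw [e]
  nlinarith [mul_le_mul_of_nonneg_left h hy]

lemma rpow_le_quadratic_of_le_one {y α : ℝ} (hy : 0 ≤ y) (hy1 : y ≤ 1) (h2 : 2 ≤ α) :
    y ^ α ≤ 1 + α * (y - 1) + α * (α - 1) / 2 * (y - 1) ^ 2 := by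
  let h : ℝ → ℝ := fun y => 1 + α * (y - 1) + α * (α - 1) / 2 * (y - 1) ^ 2 - y ^ α
  have hd : ∀ y : ℝ, HasDerivAt h (α + α * (α - 1) * (y - 1) - α * y ^ (α - 1)) y := by
    intro y
    have h1 := (hasDerivAt_id y).sub_const (1 : ℝ)
    have := (((h1.const_mul α).const_add 1).add ((h1.pow 2).const_mul (α * (α - 1) / 2))).sub
      (Real.hasDerivAt_rpow_const (x := y) (p := α) (Or.inr (by linarith)))
    refine this.congr_deriv ?_
    simp; ring
  have hanti : AntitoneOn h (Set.Icc 0 1) := by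
    refine antitoneOn_of_deriv_nonpos (convex_Icc 0 1)
      (fun y _ => (hd y).continuousAt.continuousWithinAt)
      (fun y _ => (hd y).differentiableAt.differentiableWithinAt) ?_
    -- The derivative is `α (1 + (α - 1)(z - 1) - z^(α - 1))`, nonpositive by Bernoulli.
    intro z hz
    rw [interior_Icc] at hz
    rw [(hd z).deriv]
    have := one_add_mul_self_le_rpow_one_add (s := z - 1) (by linarith [hz.1]) (p := α - 1)
      (by linarith)
    rw [add_sub_cancel] at this
    nlinarith
  have := hanti ⟨hy, hy1⟩ ⟨zero_le_one, le_rfl⟩ hy1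
  simp only [h] at this
  simp at this
  linarith

lemma rpow_sub_one_le_mul {y β : ℝ} (hy : 1 ≤ y) (hβ : 1 ≤ β) :
    y ^ β - 1 ≤ β * (y - 1) * y ^ (β - 1) := by
  have hy0 : 0 < y := by linarith
  have h := one_add_mul_self_le_rpow_one_add (s := y⁻¹ - 1) (by linarith [inv_pos.2 hy0]) hβ
  rw [add_sub_cancel, Real.inv_rpow hy0.le] at h
  have hp : 0 < y ^ β := Real.rpow_pos_of_pos hy0 _
  have h' := mul_le_mul_of_nonneg_left h hp.le
  rw [mul_inv_cancel₀ hp.ne'] at h'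
  have e : y ^ (β - 1) * y = y ^ β := by rw [Real.rpow_sub_one hy0.ne']; field_simp
  have e2 : y ^ β * (1 + β * (y⁻¹ - 1)) = y ^ β - β * (y - 1) * y ^ (β - 1) := by
    rw [← e]; field_simp; ring
  linarith

/-- Taylor's formula at `1` with the second derivative taken at `y`, where it is largest on `[1,
y]`. -/
lemma rpow_le_quadratic_of_one_le {y α : ℝ} (hy : 1 ≤ y) (h2 : 2 ≤ α) :
    y ^ α ≤ 1 + α * (y - 1) + α * (α - 1) / 2 * ((y - 1) ^ 2 * y ^ (α - 2)) := by
  let h : ℝ → ℝ := fun y =>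
    1 + α * (y - 1) + α * (α - 1) / 2 * ((y - 1) ^ 2 * y ^ (α - 2)) - y ^ α
  have hd : ∀ y : ℝ, 0 < y → HasDerivAt h (α + α * (α - 1) / 2 * (2 * (y - 1) * y ^ (α - 2) +
      (y - 1) ^ 2 * ((α - 2) * y ^ (α - 2 - 1))) - α * y ^ (α - 1)) y := by
    intro y hy
    have h1 := (hasDerivAt_id y).sub_const (1 : ℝ)
    have := (((h1.const_mul α).const_add 1).add (((h1.pow 2).mul
      (Real.hasDerivAt_rpow_const (x := y) (p := α - 2) (Or.inl hy.ne'))).const_mul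
        (α * (α - 1) / 2))).sub
      (Real.hasDerivAt_rpow_const (x := y) (p := α) (Or.inr (by linarith)))
    refine this.congr_deriv ?_
    simp
  have hmono : MonotoneOn h (Set.Ici 1) := by
    refine monotoneOn_of_deriv_nonneg (convex_Ici 1)
      (fun y hy => (hd y (zero_lt_one.trans_le hy)).continuousAt.continuousWithinAt)
      (fun y hy => (hd y (zero_lt_one.trans_le (interior_subset hy))).differentiableAt
        |>.differentiableWithinAt) ?_
    intro z hz
    have hz1 : 1 ≤ z := interior_subset hz
    rw [(hd z (by linarith)).deriv]
    have h3 := rpow_sub_one_le_mul hz1 (β := α - 1) (by linarith)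
    rw [show α - 1 - 1 = α - 2 by ring] at h3
    have h4 : 0 ≤ α * (α - 1) / 2 * ((z - 1) ^ 2 * ((α - 2) * z ^ (α - 2 - 1))) := by
      have : 0 ≤ α - 1 := by linarith
      have : 0 ≤ α - 2 := by linarith
      have : 0 ≤ α := by linarith
      positivity
    nlinarith
  have := hmono (Set.mem_Ici.2 le_rfl) hy hy
  simp only [h] at this
  simp at this
  linarith

/-- Convexity of `x^m` at the points `1` and `v/c` with weights `1/(1+c)` and `c/(1+c)`. The
parameter `c` is free and is tuned later. -/
lemma one_add_rpow_le_interpolate {v c m : ℝ} (hv : 0 ≤ v) (hc : 0 < c) (hm : 1 ≤ m) :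
    (1 + v) ^ m ≤ (1 + c) ^ (m - 1) * (1 + c ^ (1 - m) * v ^ m) := by
  have hc1 : 0 < 1 + c := by linarith
  have h := (convexOn_rpow hm).2 (Set.mem_Ici.2 zero_le_one)
    (Set.mem_Ici.2 (show 0 ≤ v / c by positivity)) (show 0 ≤ 1 / (1 + c) by positivity)
    (show 0 ≤ c / (1 + c) by positivity) (by field_simp)
  simp only [smul_eq_mul, Real.one_rpow] at h
  have e : 1 / (1 + c) * 1 + c / (1 + c) * (v / c) = (1 + v) / (1 + c) := by field_simp
  rw [e, Real.div_rpow (by positivity) hc1.le, div_le_iff₀ (by positivity),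
    Real.div_rpow hv hc.le] at h
  refine h.trans_eq ?_
  rw [Real.rpow_sub_one hc1.ne', Real.rpow_sub hc, Real.rpow_one]
  field_simp

/-! ### Numerical estimates in the range `s ≤ 10/7` -/

lemma exp_five_sevenths_le : Real.exp (5 / 7) ≤ 2.05 := by
  have := Real.exp_bound' (x := 5 / 7) (by norm_num) (by norm_num) (n := 5) (by norm_num)
  refine this.trans ?_
  norm_num [Finset.sum_range_succ, Nat.factorial]

lemma two_mul_exp_sub_exp_half_le {s : ℝ} (h0 : 0 ≤ s) (hs : s ≤ 10 / 7) :
    2 * (Real.exp (s / 2) ^ 2 - Real.exp (s / 2)) ≤ 3.5 * s := by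
  have h1 : Real.exp (s / 2) ≤ 2.05 :=
    (Real.exp_le_exp.2 (by linarith)).trans exp_five_sevenths_le
  have h2 : Real.exp (s / 2) ≤ 1 + 1.5 * (s / 2) := by
    have := Real.exp_bound' (x := s / 2) (by linarith) (by linarith) (n := 3) (by norm_num)
    refine this.trans ?_
    norm_num [Finset.sum_range_succ, Nat.factorial]
    nlinarith [mul_nonneg h0 h0, mul_nonneg h0 (sub_nonneg.2 hs),
      mul_nonneg (mul_nonneg h0 h0) (sub_nonneg.2 hs)]
  have h3 : 1 ≤ Real.exp (s / 2) := Real.one_le_exp (by linarith)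
  nlinarith

/-- The extreme case is the corner `x = y = E`; after multiplication by `E` the gap is exactly the
sum of the two products `h1` and `h2`. -/
lemma sq_add_sq_sub_le {x y E : ℝ} (hx : 1 ≤ x) (hxE : x ≤ E) (hy : 1 ≤ y) (hyE : y ≤ E) :
    x ^ 2 + y ^ 2 - 2 * (x * y / E) ≤ 2 * (E ^ 2 - E) := by
  have hE : 1 ≤ E := hx.trans hxE
  have hE0 : 0 < E := by linarith
  have e : x ^ 2 + y ^ 2 - 2 * (x * y / E) = (E * (x ^ 2 + y ^ 2) - 2 * (x * y)) / E := by
    field_simp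
  rw [e, div_le_iff₀ hE0]
  have h1 : 0 ≤ (E - x) * (E * (E + x) - (E + y)) :=
    mul_nonneg (by linarith) (by nlinarith)
  have h2 : 0 ≤ (E - y) * (E * (E + y) - (E + x)) :=
    mul_nonneg (by linarith) (by nlinarith)
  nlinarith

/-! ### Taylor bounds for the Rényi integrand -/

/-- Pointwise bound on the integrand of the Rényi divergence of `Q + q (a - b)` from `Q`. -/
def RenyiCoeffBound (α q s k₀ k₁ k₂ l : ℝ) : Prop :=
  (∀ a b Q : ℝ, 0 < a → 0 < b → 0 < Q → 0 ≤ Q + q * (a - b) →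
    (Q + q * (a - b)) ^ α * Q ^ (1 - α) ≤ Q + α * (q * (a - b)) + α * (α - 1) * q ^ 2 *
      (k₀ * ((a - b) ^ 2 * Q ^ (-1 : ℝ)) + k₁ * (a ^ 2 * Q ^ (-1 : ℝ)) +
        k₂ * (a ^ (l + 2) * Q ^ (-(l + 1))))) ∧
  k₀ * (3.5 * s) + k₁ * Real.exp s + k₂ * Real.exp ((l + 1) * (l + 2) / 2 * s) ≤ 3.5 * s

lemma add_rpow_mul_rpow_eq {Q u α : ℝ} (hQ : 0 < Q) (h : 0 ≤ Q + u) :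
    (Q + u) ^ α * Q ^ (1 - α) = Q * (1 + u / Q) ^ α := by
  have e : 1 + u / Q = (Q + u) / Q := by field_simp
  rw [e, Real.div_rpow h hQ.le, Real.rpow_sub hQ, Real.rpow_one]
  ring

lemma renyiCoeffBound_of_le_two {α q s : ℝ} (h1 : 1 < α) (h2 : α ≤ 2) :
    RenyiCoeffBound α q s 1 0 0 1 := by
  refine ⟨fun a b Q ha hb hQ hP => ?_, by simp⟩
  have hy : 0 ≤ 1 + q * (a - b) / Q := by
    rw [show 1 + q * (a - b) / Q = (Q + q * (a - b)) / Q by field_simp]; positivity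
  rw [add_rpow_mul_rpow_eq hQ hP, Real.rpow_neg_one]
  have h := mul_le_mul_of_nonneg_left (rpow_le_quadratic_of_le_two hy h1 h2) hQ.le
  refine h.trans ?_
  have e : Q * (1 + α * (1 + q * (a - b) / Q - 1) + (α - 1) * (1 + q * (a - b) / Q - 1) ^ 2) =
      Q + α * (q * (a - b)) + (α - 1) * q ^ 2 * ((a - b) ^ 2 * Q⁻¹) := by
    field_simp; ring
  rw [e]
  have h3 : 0 ≤ (α - 1) * ((α - 1) * q ^ 2 * ((a - b) ^ 2 * Q⁻¹)) := by
    have : 0 ≤ α - 1 := by linarith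
    positivity
  nlinarith

/-- For exponents at least `2`, the bound reduces to one on `(1 + v) ^ (α - 2) - 1`. -/
lemma add_rpow_mul_rpow_le {α q a b Q R : ℝ} (h2 : 2 ≤ α) (hq : 0 ≤ q) (ha : 0 < a) (hb : 0 < b)
    (hQ : 0 < Q) (hP : 0 ≤ Q + q * (a - b))
    (hR : a ^ 2 * Q⁻¹ * ((1 + q * a / Q) ^ (α - 2) - 1) ≤ R) :
    (Q + q * (a - b)) ^ α * Q ^ (1 - α) ≤ Q + α * (q * (a - b)) + α * (α - 1) / 2 * q ^ 2 *
      ((a - b) ^ 2 * Q⁻¹ + R) := by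
  have hα : 0 ≤ α * (α - 1) / 2 := by nlinarith
  have hv : 1 ≤ (1 + q * a / Q) ^ (α - 2) :=
    Real.one_le_rpow (by have : 0 ≤ q * a / Q := by positivity
                         linarith) (by linarith)
  have hR0 : 0 ≤ R := le_trans (mul_nonneg (by positivity) (by linarith)) hR
  have hy : 0 ≤ 1 + q * (a - b) / Q := by
    rw [show 1 + q * (a - b) / Q = (Q + q * (a - b)) / Q by field_simp]; positivity
  rw [add_rpow_mul_rpow_eq hQ hP]
  rcases le_total (q * (a - b)) 0 with h | h
  · have hy1 : 1 + q * (a - b) / Q ≤ 1 := by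
      have := div_nonpos_of_nonpos_of_nonneg h hQ.le
      linarith
    refine (mul_le_mul_of_nonneg_left (rpow_le_quadratic_of_le_one hy hy1 h2) hQ.le).trans ?_
    have e : Q * (1 + α * (1 + q * (a - b) / Q - 1) +
        α * (α - 1) / 2 * (1 + q * (a - b) / Q - 1) ^ 2) =
        Q + α * (q * (a - b)) + α * (α - 1) / 2 * q ^ 2 * ((a - b) ^ 2 * Q⁻¹) := by
      field_simp; ring
    rw [e]
    have : 0 ≤ α * (α - 1) / 2 * q ^ 2 * R := by positivity
    linarith
  -- Only an increase of the density produces a correction to the quadratic term; there `b` is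
  -- dropped, so that the correction involves `a` and `Q` only.
  · have hu : 0 ≤ q * (a - b) / Q := div_nonneg h hQ.le
    have hua : q * (a - b) / Q ≤ q * a / Q := by
      gcongr
      linarith
    refine (mul_le_mul_of_nonneg_left
      (rpow_le_quadratic_of_one_le (by linarith) h2) hQ.le).trans ?_
    have hpow : (1 + q * (a - b) / Q) ^ (α - 2) ≤ (1 + q * a / Q) ^ (α - 2) :=
      Real.rpow_le_rpow hy (by linarith) (by linarith)
    set Y := (1 + q * (a - b) / Q) ^ (α - 2)
    set V := (1 + q * a / Q) ^ (α - 2)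
    have e : Q * (1 + α * (1 + q * (a - b) / Q - 1) +
        α * (α - 1) / 2 * ((1 + q * (a - b) / Q - 1) ^ 2 * Y)) =
        Q + α * (q * (a - b)) + α * (α - 1) / 2 *
          (q ^ 2 * (a - b) ^ 2 * Q⁻¹ + Q⁻¹ * (q * (a - b)) ^ 2 * (Y - 1)) := by
      field_simp; ring
    rw [e]
    have h3 : Q⁻¹ * (q * (a - b)) ^ 2 * (Y - 1) ≤ q ^ 2 * R := by
      calc Q⁻¹ * (q * (a - b)) ^ 2 * (Y - 1) ≤ Q⁻¹ * (q * (a - b)) ^ 2 * (V - 1) := by gcongr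
        _ ≤ Q⁻¹ * (q * a) ^ 2 * (V - 1) := by
          have : 0 ≤ V - 1 := by linarith
          have : q * (a - b) ≤ q * a := by nlinarith
          gcongr
        _ = q ^ 2 * (a ^ 2 * Q⁻¹ * (V - 1)) := by ring
        _ ≤ q ^ 2 * R := by gcongr
    have := mul_le_mul_of_nonneg_left h3 hα
    linarith

/-- Here `α - 2 ≤ 1`, so Bernoulli bounds the correction by a multiple of `a³/Q²`. Its integral may
use up the half of `3.5 s` left by `k₀ = 1/2`. -/
lemma renyiCoeffBound_of_le_three {α q s : ℝ} (h2 : 2 ≤ α) (h3 : α ≤ 3) (hq : 0 ≤ q) (hs : 0 ≤ s)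
    (hs' : s ≤ 10 / 7) (hqs : q * α * (1 + s) * Real.exp (1.5 * (α - 1) * s) ≤ s) :
    RenyiCoeffBound α q s (1 / 2) 0 (1 / 2 * ((α - 2) * q)) 1 := by
  refine ⟨fun a b Q ha hb hQ hP => ?_, ?_⟩
  · have hb := rpow_one_add_le_one_add_mul_self (s := q * a / Q) (p := α - 2)
      (by have : 0 ≤ q * a / Q := by positivity
          linarith) (by linarith) (by linarith)
    have := add_rpow_mul_rpow_le (R := (α - 2) * q * (a ^ 3 * (Q ^ 2)⁻¹)) h2 hq ha ‹_› hQ hP (by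
      refine (mul_le_mul_of_nonneg_left (sub_le_sub_right hb 1) (by positivity)).trans_eq ?_
      field_simp; ring)
    refine this.trans_eq ?_
    rw [Real.rpow_neg hQ.le, Real.rpow_neg hQ.le, Real.rpow_one]
    norm_num
    ring
  · have hE : Real.exp (1.5 * s) ≤ 10.5 := by
      have h1 : Real.exp (1.5 * s) ≤ Real.exp (5 / 7) ^ 3 := by
        rw [← Real.exp_nat_mul]
        exact Real.exp_le_exp.2 (by push_cast; linarith)
      have h2 := pow_le_pow_left₀ (Real.exp_pos _).le exp_five_sevenths_le 3
      norm_num at h2 ⊢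
      norm_num at h1
      linarith
    have hmono : q * (1 + s) * (α * Real.exp (1.5 * s)) ≤ s := by
      refine le_trans ?_ hqs
      have : Real.exp (1.5 * s) ≤ Real.exp (1.5 * (α - 1) * s) :=
        Real.exp_le_exp.2 (by nlinarith)
      calc _ = q * α * (1 + s) * Real.exp (1.5 * s) := by ring
        _ ≤ _ := by
          have : 0 ≤ α := by linarith
          gcongr
    have e3 : Real.exp ((1 + 1) * (1 + 2) / 2 * s) = Real.exp (1.5 * s) * Real.exp (1.5 * s) := by
      rw [← Real.exp_add]; ring_nf
    rw [e3]
    have hqE : q * (α * Real.exp (1.5 * s)) ≤ s := by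
      have : 0 ≤ q * (α * Real.exp (1.5 * s)) := by
        have : 0 ≤ α := by linarith
        positivity
      nlinarith
    -- `α - 2 ≤ α/3` because `α ≤ 3`; then `s/3 * 10.5 = 3.5 s`.
    have h4 : (α - 2) * q * Real.exp (1.5 * s) ≤ s / 3 := by
      have : 0 ≤ q * Real.exp (1.5 * s) := by positivity
      nlinarith
    have h5 : (α - 2) * q * Real.exp (1.5 * s) * Real.exp (1.5 * s) ≤ s / 3 * 10.5 := by
      refine mul_le_mul h4 hE (Real.exp_pos _).le (by linarith)
    nlinarith

lemma renyiCoeffBound_of_three_le {α q s : ℝ} (h3 : 3 ≤ α) (hq : 0 < q) (hs : 0 ≤ s)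
    (hqs : q * α * (1 + s) * Real.exp (1.5 * (α - 1) * s) ≤ s) :
    ∃ k₁ k₂ l, 0 ≤ k₁ ∧ 0 ≤ k₂ ∧ 1 ≤ l ∧ RenyiCoeffBound α q s (1 / 2) k₁ k₂ l := by
  obtain ⟨m, rfl⟩ : ∃ m, α = m + 2 := ⟨α - 2, by ring⟩
  have hm : 1 ≤ m := by linarith
  -- This `c` makes the moment of order `m + 2`, after its coefficient, equal to `c` times the
  -- second moment `exp s` (see `e1`), so the two corrections recombine into `((1 + c)^m - 1) exp s
  -- / 2`.
  set c := q * Real.exp ((1.5 + m / 2) * s) with hc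
  have hc0 : 0 < c := by positivity
  have hcm1 : 1 ≤ (1 + c) ^ (m - 1) := Real.one_le_rpow (by linarith) (by linarith)
  refine ⟨1 / 2 * ((1 + c) ^ (m - 1) - 1), 1 / 2 * ((1 + c) ^ (m - 1) * c ^ (1 - m) * q ^ m), m,
    by linarith, by positivity, hm, fun a b Q ha hb hQ hP => ?_, ?_⟩
  · have hint := one_add_rpow_le_interpolate (v := q * a / Q) (by positivity) hc0 hm
    have := add_rpow_mul_rpow_le (R := ((1 + c) ^ (m - 1) - 1) * (a ^ 2 * Q⁻¹) +
        (1 + c) ^ (m - 1) * c ^ (1 - m) * q ^ m * (a ^ (m + 2) * Q ^ (-(m + 1))))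
      (by linarith : 2 ≤ m + 2) hq.le ha hb hQ hP (by
      rw [add_sub_cancel_right]
      refine (mul_le_mul_of_nonneg_left (sub_le_sub_right hint 1) (by positivity)).trans_eq ?_
      rw [Real.div_rpow (by positivity) hQ.le, Real.mul_rpow hq.le ha.le, Real.rpow_neg hQ.le,
        Real.rpow_add_one hQ.ne', Real.rpow_add ha, Real.rpow_two]
      have : 0 < Q ^ m := Real.rpow_pos_of_pos hQ _
      field_simp; ring)
    refine this.trans_eq ?_
    rw [Real.rpow_neg_one]
    ring
  · have hcs : m * c ≤ s / (1 + s) * Real.exp (-s) := by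
      rw [div_mul_eq_mul_div, le_div_iff₀ (by linarith)]
      have h1 : q * (m + 2) * (1 + s) * Real.exp (1.5 * (m + 2 - 1) * s) * Real.exp (-s) ≤
          s * Real.exp (-s) := mul_le_mul_of_nonneg_right hqs (Real.exp_pos _).le
      refine le_trans ?_ h1
      rw [mul_assoc _ (Real.exp _), ← Real.exp_add]
      have h2 : Real.exp ((1.5 + m / 2) * s) ≤ Real.exp (1.5 * (m + 2 - 1) * s + -s) :=
        Real.exp_le_exp.2 (by nlinarith)
      calc m * c * (1 + s) = q * m * (1 + s) * Real.exp ((1.5 + m / 2) * s) := by rw [hc]; ring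
        _ ≤ q * (m + 2) * (1 + s) * Real.exp (1.5 * (m + 2 - 1) * s + -s) := by
          gcongr
          linarith
    have hy1 : m * c ≤ s / (1 + s) := hcs.trans
      (mul_le_of_le_one_right (by positivity) (Real.exp_le_one_iff.2 (by linarith)))
    have hs1 : s / (1 + s) = 1 - 1 / (1 + s) := by field_simp; ring
    have h1s : 0 < 1 / (1 + s) := by positivity
    -- With `y = m c`: `(1+c)^m ≤ exp y` and `exp y (1 - y) ≤ 1`, while `y ≤ s/(1+s)` gives `exp y -
    -- 1 ≤ y (1 + s)`.
    have hpow : (1 + c) ^ m - 1 ≤ s * Real.exp (-s) := by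
      have h1 : (1 + c) ^ m ≤ Real.exp (m * c) := by
        rw [mul_comm, Real.exp_mul]
        refine Real.rpow_le_rpow (by linarith) ?_ (by linarith)
        linarith [Real.add_one_le_exp c]
      have h2 : Real.exp (m * c) * (1 - m * c) ≤ 1 := by
        have := Real.add_one_le_exp (-(m * c))
        have h := mul_le_mul_of_nonneg_left this (Real.exp_pos (m * c)).le
        rw [← Real.exp_add] at h
        simp only [add_neg_cancel, Real.exp_zero] at h
        linarith
      have h4 : 1 / (1 + s) ≤ 1 - m * c := by linarith
      have h5 : Real.exp (m * c) - 1 ≤ m * c * (1 + s) := by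
        have h6 : (Real.exp (m * c) - 1) * (1 - m * c) ≤ m * c := by linarith
        have h7 : (Real.exp (m * c) - 1) * (1 / (1 + s)) ≤ m * c := by
          refine le_trans (mul_le_mul_of_nonneg_left h4 ?_) h6
          have := Real.one_le_exp (show 0 ≤ m * c by positivity)
          linarith
        rwa [mul_one_div, div_le_iff₀ (by linarith)] at h7
      have h8 : m * c * (1 + s) ≤ s * Real.exp (-s) := by
        rwa [div_mul_eq_mul_div, le_div_iff₀ (by linarith)] at hcs
      linarith
    have e1 : c ^ (1 - m) * q ^ m * Real.exp ((m + 1) * (m + 2) / 2 * s) = c * Real.exp s := by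
      rw [Real.rpow_sub hc0, Real.rpow_one, hc, Real.mul_rpow hq.le (Real.exp_pos _).le,
        ← Real.exp_mul]
      have : 0 < q ^ m := Real.rpow_pos_of_pos hq _
      field_simp
      rw [← Real.exp_add]
      congr 1
      ring
    have e2 : (1 + c) ^ m = (1 + c) ^ (m - 1) * (1 + c) := by
      rw [Real.rpow_sub_one (by positivity)]
      field_simp
    have e3 : 1 / 2 * ((1 + c) ^ (m - 1) - 1) * Real.exp s +
        1 / 2 * ((1 + c) ^ (m - 1) * c ^ (1 - m) * q ^ m) *
          Real.exp ((m + 1) * (m + 2) / 2 * s) = 1 / 2 * (((1 + c) ^ m - 1) * Real.exp s) := by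
      rw [e2]
      linear_combination (1 / 2 * (1 + c) ^ (m - 1)) * e1
    have h6 : ((1 + c) ^ m - 1) * Real.exp s ≤ s := by
      refine (mul_le_mul_of_nonneg_right hpow (Real.exp_pos s).le).trans_eq ?_
      rw [mul_assoc, ← Real.exp_add]
      simp
    linarith

lemma exists_renyiCoeffBound {α q s : ℝ} (h1 : 1 < α) (hq : 0 < q) (hs : 0 ≤ s)
    (hs' : s ≤ 10 / 7) (hqs : q * α * (1 + s) * Real.exp (1.5 * (α - 1) * s) ≤ s) :
    ∃ k₀ k₁ k₂ l, 0 ≤ k₀ ∧ 0 ≤ k₁ ∧ 0 ≤ k₂ ∧ 1 ≤ l ∧ RenyiCoeffBound α q s k₀ k₁ k₂ l := by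
  rcases le_total α 2 with h2 | h2
  · exact ⟨1, 0, 0, 1, by simp, by simp, by simp, le_rfl, renyiCoeffBound_of_le_two h1 h2⟩
  rcases le_total α 3 with h3 | h3
  · refine ⟨1 / 2, 0, 1 / 2 * ((α - 2) * q), 1, by simp, by simp, ?_, le_rfl,
      renyiCoeffBound_of_le_three h2 h3 hq.le hs hs' hqs⟩
    have : 0 ≤ α - 2 := by linarith
    positivity
  · obtain ⟨k₁, k₂, l, h⟩ := renyiCoeffBound_of_three_le h3 hq hs hqs
    exact ⟨1 / 2, k₁, k₂, l, by simp, h⟩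

/-- Negative powers of a mean are at most the mean of the negative powers. -/
lemma mean_rpow_neg_le {n : ℕ} (hn : 0 < n) (r : Fin n → ℝ) (hr : ∀ i, 0 < r i) {k : ℝ}
    (hk : 1 ≤ k) :
    (∑ i, (1 / n : ℝ) * r i) ^ (-k) ≤ ∑ i, (1 / n : ℝ) * r i ^ (-k) := by
  have hn' : (0 : ℝ) < n := by exact_mod_cast hn
  have hw : ∑ _i : Fin n, (1 / n : ℝ) = 1 := by simp [hn'.ne']
  have hne : (Finset.univ : Finset (Fin n)).Nonempty := ⟨⟨0, hn⟩, Finset.mem_univ _⟩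
  have hS : 0 < ∑ i, (1 / n : ℝ) * r i :=
    Finset.sum_pos (fun i _ => mul_pos (by positivity) (hr i)) hne
  have hinv : (∑ i, (1 / n : ℝ) * r i)⁻¹ ≤ ∑ i, (1 / n : ℝ) * (r i)⁻¹ := by
    have := (convexOn_zpow (𝕜 := ℝ) (-1)).map_sum_le (t := Finset.univ)
      (w := fun _ : Fin n => (1 / n : ℝ)) (p := r) (fun _ _ => by positivity) hw
      (fun i _ => hr i)
    simpa using this
  have hpow := Real.rpow_arith_mean_le_arith_mean_rpow Finset.univ
    (fun _ : Fin n => (1 / n : ℝ)) (fun i => (r i)⁻¹) (fun _ _ => by positivity) hw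
    (fun i _ => (inv_pos.2 (hr i)).le) hk
  have e : ∀ x : ℝ, 0 < x → x ^ (-k) = (x⁻¹) ^ k := fun x hx => by
    rw [Real.rpow_neg hx.le, Real.inv_rpow hx.le]
  rw [e _ hS]
  simp_rw [fun i => e _ (hr i)]
  exact (Real.rpow_le_rpow (inv_pos.2 hS).le hinv (by linarith)).trans hpow

/-! ### Translates of the standard Gaussian measure -/

section GaussianShift

set_option linter.unusedSectionVars false

open scoped RealInnerProductSpace

variable {H : Type*} [NormedAddCommGroup H] [InnerProductSpace ℝ H] [FiniteDimensional ℝ H]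
  [MeasurableSpace H] [BorelSpace H]

/-- The exponential factors over an orthonormal basis. The case `t = 0` gives the real exponential
moments; general `t` gives the characteristic function of the exponentially tilted measure. -/
lemma integral_cexp_inner_add_stdGaussian (a t : H) :
    ∫ x, Complex.exp (⟪x, a⟫ + ⟪x, t⟫ * Complex.I) ∂(stdGaussian H) =
      Complex.exp ((‖a‖ ^ 2 - ‖t‖ ^ 2) / 2 + ⟪a, t⟫ * Complex.I) := by
  rw [stdGaussian, integral_map (Measurable.aemeasurable (by fun_prop))
    (Measurable.aestronglyMeasurable (by fun_prop))]
  set b := stdOrthonormalBasis ℝ H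
  have e : ∀ x : Fin (Module.finrank ℝ H) → ℝ,
      Complex.exp (⟪∑ i, x i • b i, a⟫ + ⟪∑ i, x i • b i, t⟫ * Complex.I) =
      ∏ i, Complex.exp ((⟪b i, a⟫ + ⟪b i, t⟫ * Complex.I) * x i) := by
    intro x
    rw [← Complex.exp_sum, sum_inner, sum_inner]
    push_cast
    rw [Finset.sum_mul, ← Finset.sum_add_distrib]
    congr 1
    refine Finset.sum_congr rfl fun i _ => ?_
    rw [real_inner_smul_left, real_inner_smul_left]
    push_cast; ring
  simp_rw [e]
  rw [integral_fintype_prod_eq_prod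
    (f := fun i (x : ℝ) => Complex.exp ((⟪b i, a⟫ + ⟪b i, t⟫ * Complex.I) * x))]
  have h1 : ∀ z : ℂ, ∫ x : ℝ, Complex.exp (z * x) ∂(gaussianReal 0 1) = Complex.exp (z ^ 2 / 2) := by
    intro z
    have := complexMGF_id_gaussianReal (μ := 0) (v := 1) z
    simpa [complexMGF] using this
  simp_rw [h1]
  rw [← Complex.exp_sum]
  congr 1
  have ha : (‖a‖ ^ 2 : ℂ) = ∑ i, (⟪b i, a⟫ : ℂ) ^ 2 := by
    rw [← Complex.ofReal_pow, ← b.sum_sq_inner_right a]; push_cast; rfl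
  have ht : (‖t‖ ^ 2 : ℂ) = ∑ i, (⟪b i, t⟫ : ℂ) ^ 2 := by
    rw [← Complex.ofReal_pow, ← b.sum_sq_inner_right t]; push_cast; rfl
  have hat : (⟪a, t⟫ : ℂ) = ∑ i, (⟪b i, a⟫ : ℂ) * ⟪b i, t⟫ := by
    rw [← b.sum_inner_mul_inner a t]; push_cast
    exact Finset.sum_congr rfl fun i _ => by rw [real_inner_comm]
  rw [ha, ht, hat, ← Finset.sum_sub_distrib, Finset.sum_div, Finset.sum_mul,
    ← Finset.sum_add_distrib]
  refine Finset.sum_congr rfl fun i _ => ?_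
  linear_combination (⟪b i, t⟫ : ℂ) ^ 2 / 2 * Complex.I_sq

lemma integrable_exp_inner_stdGaussian (v : H) :
    Integrable (fun z => Real.exp ⟪v, z⟫) (stdGaussian H) := by
  have h : (stdGaussian H).map (innerSL ℝ v) = gaussianReal 0 (‖v‖ ^ 2).toNNReal := by
    rw [IsGaussian.map_eq_gaussianReal, integral_strongDual_stdGaussian,
      variance_dual_stdGaussian, innerSL_apply_norm]
  have h2 := integrable_exp_mul_gaussianReal (μ := 0) (v := (‖v‖ ^ 2).toNNReal) 1
  rw [← h] at h2
  have := (integrable_map_measure (by fun_prop) (by fun_prop)).1 h2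
  simpa [Function.comp_def] using this

lemma integral_exp_inner_stdGaussian (v : H) :
    ∫ z, Real.exp ⟪v, z⟫ ∂(stdGaussian H) = Real.exp (‖v‖ ^ 2 / 2) := by
  have h := integral_cexp_inner_add_stdGaussian v 0
  simp only [inner_zero_right, Complex.ofReal_zero, zero_mul, add_zero, norm_zero] at h
  have e : ∀ x : H, Complex.exp ⟪x, v⟫ = ((Real.exp ⟪v, x⟫ : ℝ) : ℂ) := fun x => by
    rw [real_inner_comm]; push_cast; rfl
  simp_rw [e] at h
  rw [integral_complex_ofReal] at h
  have h' : ((∫ z, Real.exp ⟪v, z⟫ ∂(stdGaussian H) : ℝ) : ℂ) =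
      ((Real.exp (‖v‖ ^ 2 / 2) : ℝ) : ℂ) := by
    rw [h]; push_cast; simp
  exact_mod_cast h'

/-- The density of the translate of the standard Gaussian by `a` with respect to the standard
Gaussian. -/
def gaussianShiftDensity (a z : H) : ℝ := Real.exp (⟪a, z⟫ - ‖a‖ ^ 2 / 2)

lemma gaussianShiftDensity_pos (a z : H) : 0 < gaussianShiftDensity a z := Real.exp_pos _

lemma measurable_gaussianShiftDensity (a : H) : Measurable (gaussianShiftDensity a) := by
  unfold gaussianShiftDensity; fun_prop

lemma integrable_exp_inner_sub_stdGaussian (v : H) (k : ℝ) :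
    Integrable (fun z => Real.exp (⟪v, z⟫ - k)) (stdGaussian H) := by
  simp_rw [Real.exp_sub]
  exact (integrable_exp_inner_stdGaussian v).div_const _

lemma integral_exp_inner_sub_stdGaussian (v : H) (k : ℝ) :
    ∫ z, Real.exp (⟪v, z⟫ - k) ∂(stdGaussian H) = Real.exp (‖v‖ ^ 2 / 2 - k) := by
  simp_rw [Real.exp_sub]
  rw [integral_div, integral_exp_inner_stdGaussian]

lemma integrable_gaussianShiftDensity (a : H) :
    Integrable (gaussianShiftDensity a) (stdGaussian H) :=
  integrable_exp_inner_sub_stdGaussian _ _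

lemma integral_gaussianShiftDensity (a : H) :
    ∫ z, gaussianShiftDensity a z ∂(stdGaussian H) = 1 := by
  simp [gaussianShiftDensity, integral_exp_inner_sub_stdGaussian]

/-- The Cameron-Martin formula for the standard Gaussian measure. -/
lemma map_const_add_stdGaussian (a : H) :
    (stdGaussian H).map (fun z => a + z) =
      (stdGaussian H).withDensity (fun z => ENNReal.ofReal (gaussianShiftDensity a z)) := by
  have hfin : IsFiniteMeasure ((stdGaussian H).withDensity
      (fun z => ENNReal.ofReal (gaussianShiftDensity a z))) :=
    isFiniteMeasure_withDensity_ofReal (integrable_gaussianShiftDensity a).2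
  have : IsProbabilityMeasure ((stdGaussian H).map (fun z => a + z)) :=
    Measure.isProbabilityMeasure_map (by fun_prop)
  -- Both characteristic functions are values of `integral_cexp_inner_add_stdGaussian`, at `0` for
  -- the translate and at `a` for the density.
  refine Measure.ext_of_charFun ?_
  ext t
  rw [charFun_apply, charFun_apply, integral_map (by fun_prop) (by fun_prop),
    integral_withDensity_eq_integral_toReal_smul
      (measurable_gaussianShiftDensity a).ennreal_ofReal (by simp)]
  have e1 : ∀ x : H, Complex.exp (⟪a + x, t⟫ * Complex.I) =
      Complex.exp (⟪a, t⟫ * Complex.I) * Complex.exp (⟪x, (0 : H)⟫ + ⟪x, t⟫ * Complex.I) := by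
    intro x
    rw [← Complex.exp_add, inner_add_left, inner_zero_right]
    push_cast; ring_nf
  have e2 : ∀ x : H, (ENNReal.ofReal (gaussianShiftDensity a x)).toReal •
      Complex.exp (⟪x, t⟫ * Complex.I) = Complex.exp (-(‖a‖ ^ 2 / 2)) *
        Complex.exp (⟪x, a⟫ + ⟪x, t⟫ * Complex.I) := by
    intro x
    rw [ENNReal.toReal_ofReal (gaussianShiftDensity_pos a x).le, gaussianShiftDensity,
      Complex.real_smul, ← Complex.exp_add, Complex.ofReal_exp, ← Complex.exp_add,
      real_inner_comm]
    push_cast; ring_nf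
  simp_rw [e1, e2, integral_const_mul, integral_cexp_inner_add_stdGaussian]
  rw [← Complex.exp_add, ← Complex.exp_add]
  simp only [norm_zero, inner_zero_left]
  push_cast
  ring_nf

lemma lintegral_const_add_stdGaussian (a : H) {g : H → ENNReal} (hg : Measurable g) :
    ∫⁻ z, g (a + z) ∂(stdGaussian H) =
      ∫⁻ z, ENNReal.ofReal (gaussianShiftDensity a z) * g z ∂(stdGaussian H) := by
  rw [← lintegral_map hg (measurable_const_add a), map_const_add_stdGaussian,
    lintegral_withDensity_eq_lintegral_mul _
      (measurable_gaussianShiftDensity a).ennreal_ofReal hg]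
  rfl

lemma gaussianShiftDensity_rpow_mul_rpow (a r : H) (l : ℝ) (z : H) :
    gaussianShiftDensity a z ^ (l + 2) * gaussianShiftDensity r z ^ (-(l + 1)) =
      Real.exp (⟪(l + 2) • a - (l + 1) • r, z⟫ -
        ((l + 2) * ‖a‖ ^ 2 - (l + 1) * ‖r‖ ^ 2) / 2) := by
  rw [gaussianShiftDensity, gaussianShiftDensity, ← Real.exp_mul, ← Real.exp_mul, ← Real.exp_add,
    inner_sub_left, real_inner_smul_left, real_inner_smul_left]
  ring_nf

lemma integrable_gaussianShiftDensity_rpow (a r : H) (l : ℝ) :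
    Integrable (fun z => gaussianShiftDensity a z ^ (l + 2) *
      gaussianShiftDensity r z ^ (-(l + 1))) (stdGaussian H) := by
  simp_rw [gaussianShiftDensity_rpow_mul_rpow]
  exact integrable_exp_inner_sub_stdGaussian _ _

lemma integral_gaussianShiftDensity_rpow (a r : H) (l : ℝ) :
    ∫ z, gaussianShiftDensity a z ^ (l + 2) * gaussianShiftDensity r z ^ (-(l + 1))
      ∂(stdGaussian H) = Real.exp ((l + 1) * (l + 2) / 2 * ‖a - r‖ ^ 2) := by
  simp_rw [gaussianShiftDensity_rpow_mul_rpow, integral_exp_inner_sub_stdGaussian]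
  congr 1
  rw [norm_sub_sq_real, norm_sub_sq_real, norm_smul, norm_smul, mul_pow, mul_pow,
    real_inner_smul_left, real_inner_smul_right, Real.norm_eq_abs, Real.norm_eq_abs, sq_abs, sq_abs]
  ring

lemma gaussianShiftDensity_mul_div (a b r z : H) :
    gaussianShiftDensity a z * gaussianShiftDensity b z * gaussianShiftDensity r z ^ (-1 : ℝ) =
      Real.exp (⟪a + b - r, z⟫ - (‖a‖ ^ 2 + ‖b‖ ^ 2 - ‖r‖ ^ 2) / 2) := by
  rw [gaussianShiftDensity, gaussianShiftDensity, gaussianShiftDensity, ← Real.exp_mul,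
    ← Real.exp_add, ← Real.exp_add, inner_sub_left, inner_add_left]
  ring_nf

lemma integrable_gaussianShiftDensity_mul_div (a b r : H) :
    Integrable (fun z => gaussianShiftDensity a z * gaussianShiftDensity b z *
      gaussianShiftDensity r z ^ (-1 : ℝ)) (stdGaussian H) := by
  simp_rw [gaussianShiftDensity_mul_div]
  exact integrable_exp_inner_sub_stdGaussian _ _

lemma integral_gaussianShiftDensity_mul_div (a b r : H) :
    ∫ z, gaussianShiftDensity a z * gaussianShiftDensity b z *
      gaussianShiftDensity r z ^ (-1 : ℝ) ∂(stdGaussian H) = Real.exp ⟪a - r, b - r⟫ := by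
  simp_rw [gaussianShiftDensity_mul_div, integral_exp_inner_sub_stdGaussian]
  congr 1
  rw [norm_sub_sq_real, norm_add_sq_real, inner_add_left, inner_sub_left, inner_sub_right,
    inner_sub_right, real_inner_self_eq_norm_sq, real_inner_comm b r]
  ring

lemma sq_sub_mul_eq (x y w : ℝ) : (x - y) ^ 2 * w = x * x * w + y * y * w - 2 * (x * y * w) := by
  ring

lemma integrable_sq_sub_gaussianShiftDensity (a b r : H) :
    Integrable (fun z => (gaussianShiftDensity a z - gaussianShiftDensity b z) ^ 2 *
      gaussianShiftDensity r z ^ (-1 : ℝ)) (stdGaussian H) := by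
  simp_rw [sq_sub_mul_eq]
  exact ((integrable_gaussianShiftDensity_mul_div a a r).add
    (integrable_gaussianShiftDensity_mul_div b b r)).sub
    ((integrable_gaussianShiftDensity_mul_div a b r).const_mul 2)

/-- Expanding the square gives `exp ‖a-r‖² + exp ‖b-r‖² - 2 exp ⟪a-r, b-r⟫`. By polarization the
bound on `‖a - b‖` keeps the inner product large; this cancellation makes the constant `3.5`
possible. -/
lemma integral_sq_sub_gaussianShiftDensity_le (a b r : H) {s : ℝ} (hs : s ≤ 10 / 7)
    (har : ‖a - r‖ ^ 2 ≤ s) (hbr : ‖b - r‖ ^ 2 ≤ s) (hab : ‖a - b‖ ^ 2 ≤ s) :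
    ∫ z, (gaussianShiftDensity a z - gaussianShiftDensity b z) ^ 2 *
      gaussianShiftDensity r z ^ (-1 : ℝ) ∂(stdGaussian H) ≤ 3.5 * s := by
  have hs0 : 0 ≤ s := (sq_nonneg _).trans har
  simp_rw [sq_sub_mul_eq]
  rw [integral_sub (by exact ((integrable_gaussianShiftDensity_mul_div a a r).add
      (integrable_gaussianShiftDensity_mul_div b b r)))
    ((integrable_gaussianShiftDensity_mul_div a b r).const_mul 2),
    integral_add (integrable_gaussianShiftDensity_mul_div a a r)
    (integrable_gaussianShiftDensity_mul_div b b r), integral_const_mul]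
  simp_rw [integral_gaussianShiftDensity_mul_div, real_inner_self_eq_norm_sq]
  refine le_trans ?_ (two_mul_exp_sub_exp_half_le hs0 hs)
  refine le_trans ?_ (sq_add_sq_sub_le (x := Real.exp (‖a - r‖ ^ 2 / 2))
    (y := Real.exp (‖b - r‖ ^ 2 / 2)) (Real.one_le_exp (by positivity))
    (Real.exp_le_exp.2 (by linarith)) (Real.one_le_exp (by positivity))
    (Real.exp_le_exp.2 (by linarith)))
  rw [← Real.exp_nat_mul, ← Real.exp_nat_mul, ← Real.exp_add, ← Real.exp_sub]
  have e : ∀ x : ℝ, ((2 : ℕ) : ℝ) * (x / 2) = x := fun x => by push_cast; ring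
  rw [e, e]
  have h : ‖a - r‖ ^ 2 / 2 + ‖b - r‖ ^ 2 / 2 - s / 2 ≤ ⟪a - r, b - r⟫ := by
    have h := norm_sub_sq_real (a - r) (b - r)
    rw [sub_sub_sub_cancel_right] at h
    linarith
  have := Real.exp_le_exp.2 h
  linarith

/-- The Rényi moment of a uniform mixture of `n` Gaussians with respect to another one that differs
from it in one component only. -/
lemma lintegral_mixture_rpow_le {n : ℕ} (hn : 0 < n) (a a' : Fin n → H) (i₀ : Fin n)
    (haa : ∀ i, i ≠ i₀ → a i = a' i) {α s : ℝ} (h1 : 1 < α) (hs0 : 0 ≤ s) (hs : s ≤ 10 / 7)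
    (hqs : (1 / n : ℝ) * α * (1 + s) * Real.exp (1.5 * (α - 1) * s) ≤ s)
    (ha : ∀ i, ‖a i₀ - a' i‖ ^ 2 ≤ s) (ha' : ∀ i, ‖a' i₀ - a' i‖ ^ 2 ≤ s) :
    ∫⁻ z, ENNReal.ofReal ((∑ i, (1 / n : ℝ) * gaussianShiftDensity (a i) z) ^ α *
        (∑ i, (1 / n : ℝ) * gaussianShiftDensity (a' i) z) ^ (1 - α)) ∂(stdGaussian H) ≤
      ENNReal.ofReal (1 + α * (α - 1) * (1 / n : ℝ) ^ 2 * (3.5 * s)) := by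
  have hn' : (0 : ℝ) < n := by exact_mod_cast hn
  set q : ℝ := 1 / n with hq
  have hq0 : 0 < q := by positivity
  obtain ⟨k₀, k₁, k₂, l, hk₀, hk₁, hk₂, hl, hpt, hnum⟩ := exists_renyiCoeffBound h1 hq0 hs0 hs hqs
  let e : H → H → ℝ := gaussianShiftDensity
  let P : H → ℝ := fun z => ∑ i, q * e (a i) z
  let Q : H → ℝ := fun z => ∑ i, q * e (a' i) z
  -- The second-order term with `Q` replaced by its component `i`. The exponents `0 + 2` and `0 + 1`
  -- match the moment formula at `l = 0`.
  let Φ : Fin n → H → ℝ := fun i z =>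
    k₀ * ((e (a i₀) z - e (a' i₀) z) ^ 2 * e (a' i) z ^ (-1 : ℝ)) +
      k₁ * (e (a i₀) z ^ ((0 : ℝ) + 2) * e (a' i) z ^ (-((0 : ℝ) + 1))) +
      k₂ * (e (a i₀) z ^ (l + 2) * e (a' i) z ^ (-(l + 1)))
  have hΦint : ∀ i, Integrable (Φ i) (stdGaussian H) := fun i =>
    (((integrable_sq_sub_gaussianShiftDensity _ _ _).const_mul _).add
      ((integrable_gaussianShiftDensity_rpow _ _ _).const_mul _)).add
      ((integrable_gaussianShiftDensity_rpow _ _ _).const_mul _)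
  have hΦ : ∀ i, ∫ z, Φ i z ∂(stdGaussian H) ≤ 3.5 * s := by
    intro i
    have hval : ∫ z, Φ i z ∂(stdGaussian H) =
        k₀ * (∫ z, (e (a i₀) z - e (a' i₀) z) ^ 2 * e (a' i) z ^ (-1 : ℝ) ∂(stdGaussian H)) +
        k₁ * Real.exp ((0 + 1) * (0 + 2) / 2 * ‖a i₀ - a' i‖ ^ 2) +
        k₂ * Real.exp ((l + 1) * (l + 2) / 2 * ‖a i₀ - a' i‖ ^ 2) := by
      rw [← integral_gaussianShiftDensity_rpow, ← integral_gaussianShiftDensity_rpow,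
        ← integral_const_mul, ← integral_const_mul, ← integral_const_mul,
        ← integral_add, ← integral_add]
      · exact ((integrable_sq_sub_gaussianShiftDensity _ _ _).const_mul _).add
          ((integrable_gaussianShiftDensity_rpow _ _ _).const_mul _)
      · exact (integrable_gaussianShiftDensity_rpow _ _ _).const_mul _
      · exact (integrable_sq_sub_gaussianShiftDensity _ _ _).const_mul _
      · exact (integrable_gaussianShiftDensity_rpow _ _ _).const_mul _
    have hsq := integral_sq_sub_gaussianShiftDensity_le (a i₀) (a' i₀) (a' i) hs (ha i) (ha' i)
      (ha i₀)
    have hai := ha i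
    rw [hval]
    refine le_trans ?_ hnum
    gcongr
    linarith
  have hePos : ∀ v z, 0 < e v z := gaussianShiftDensity_pos
  have hne : (Finset.univ : Finset (Fin n)).Nonempty := ⟨i₀, Finset.mem_univ _⟩
  have hQpos : ∀ z, 0 < Q z := fun z =>
    Finset.sum_pos (fun i _ => mul_pos hq0 (hePos _ _)) hne
  have hPpos : ∀ z, 0 < P z := fun z =>
    Finset.sum_pos (fun i _ => mul_pos hq0 (hePos _ _)) hne
  have hPQ : ∀ z, P z = Q z + q * (e (a i₀) z - e (a' i₀) z) := by
    intro z
    rw [← sub_eq_iff_eq_add', ← Finset.sum_sub_distrib, Finset.sum_eq_single i₀]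
    · ring
    · intro i _ hi; rw [haa i hi, sub_self]
    · simp
  let B : H → ℝ := fun z => Q z + α * (q * (e (a i₀) z - e (a' i₀) z)) +
    α * (α - 1) * q ^ 2 * ∑ i, q * Φ i z
  have hB : ∀ z, P z ^ α * Q z ^ (1 - α) ≤ B z := by
    intro z
    have h := hpt (e (a i₀) z) (e (a' i₀) z) (Q z) (hePos _ _) (hePos _ _) (hQpos z)
      (by rw [← hPQ]; exact (hPpos z).le)
    rw [← hPQ] at h
    refine h.trans ?_
    have hJ : ∀ k : ℝ, 1 ≤ k → Q z ^ (-k) ≤ ∑ i, q * e (a' i) z ^ (-k) := fun k hk =>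
      mean_rpow_neg_le hn _ (fun i => hePos _ _) hk
    have hα : 0 ≤ α * (α - 1) * q ^ 2 := by
      have : 0 ≤ α - 1 := by linarith
      positivity
    have hea := hePos (a i₀) z
    refine add_le_add_right (mul_le_mul_of_nonneg_left ?_ hα) _
    calc _ ≤ k₀ * ((e (a i₀) z - e (a' i₀) z) ^ 2 * ∑ i, q * e (a' i) z ^ (-1 : ℝ)) +
          k₁ * (e (a i₀) z ^ 2 * ∑ i, q * e (a' i) z ^ (-1 : ℝ)) +
          k₂ * (e (a i₀) z ^ (l + 2) * ∑ i, q * e (a' i) z ^ (-(l + 1))) := by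
            have j1 := hJ 1 le_rfl
            have j2 := hJ (l + 1) (by linarith)
            gcongr
      _ = ∑ i, q * Φ i z := by
        simp only [Finset.mul_sum, ← Finset.sum_add_distrib]
        refine Finset.sum_congr rfl fun i _ => ?_
        simp only [Φ, zero_add, Real.rpow_two]
        ring
  have hQint : Integrable Q (stdGaussian H) :=
    integrable_finsetSum _ fun i _ => (integrable_gaussianShiftDensity _).const_mul _
  have hdint : Integrable (fun z => α * (q * (e (a i₀) z - e (a' i₀) z))) (stdGaussian H) :=
    (((integrable_gaussianShiftDensity _).sub (integrable_gaussianShiftDensity _)).const_mul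
      _).const_mul _
  have hSint : Integrable (fun z => ∑ i, q * Φ i z) (stdGaussian H) :=
    integrable_finsetSum _ fun i _ => (hΦint i).const_mul _
  have hBint : Integrable B (stdGaussian H) := (hQint.add hdint).add (hSint.const_mul _)
  have hBval : ∫ z, B z ∂(stdGaussian H) ≤ 1 + α * (α - 1) * q ^ 2 * (3.5 * s) := by
    have i1 : ∫ z, Q z ∂(stdGaussian H) = 1 := by
      simp only [Q]
      rw [integral_finsetSum _ fun i _ => (integrable_gaussianShiftDensity _).const_mul _]
      simp_rw [integral_const_mul]
      simp only [integral_gaussianShiftDensity]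
      simp [hq, hn'.ne']
    -- The first-order term vanishes since both densities have mass one; this leaves the factor
    -- `q²`, the gain from subsampling.
    have i2 : ∫ z, α * (q * (e (a i₀) z - e (a' i₀) z)) ∂(stdGaussian H) = 0 := by
      rw [integral_const_mul, integral_const_mul,
        integral_sub (integrable_gaussianShiftDensity _) (integrable_gaussianShiftDensity _)]
      simp only [integral_gaussianShiftDensity]
      simp
    have i3 : ∫ z, ∑ i, q * Φ i z ∂(stdGaussian H) ≤ 3.5 * s := by
      rw [integral_finsetSum _ fun i _ => (hΦint i).const_mul _]
      simp_rw [integral_const_mul]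
      calc ∑ i, q * ∫ z, Φ i z ∂(stdGaussian H) ≤ ∑ _i : Fin n, q * (3.5 * s) :=
            Finset.sum_le_sum fun i _ => mul_le_mul_of_nonneg_left (hΦ i) hq0.le
        _ = 3.5 * s := by simp [hq]; field_simp
    have : ∫ z, B z ∂(stdGaussian H) = 1 + 0 + α * (α - 1) * q ^ 2 *
        ∫ z, ∑ i, q * Φ i z ∂(stdGaussian H) := by
      have h := integral_add (hQint.add hdint) (hSint.const_mul (α * (α - 1) * q ^ 2))
      rw [integral_add' hQint hdint, i1, i2, integral_const_mul] at h
      exact h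
    rw [this, add_zero]
    have : 0 ≤ α - 1 := by linarith
    gcongr
  have hB0 : ∀ z, 0 ≤ B z := fun z => le_trans (by have := hPpos z; have := hQpos z; positivity) (hB z)
  calc _ ≤ ∫⁻ z, ENNReal.ofReal (B z) ∂(stdGaussian H) :=
        lintegral_mono fun z => ENNReal.ofReal_le_ofReal (hB z)
    _ = ENNReal.ofReal (∫ z, B z ∂(stdGaussian H)) :=
        (ofReal_integral_eq_lintegral_ofReal hBint (Filter.Eventually.of_forall hB0)).symm
    _ ≤ _ := ENNReal.ofReal_le_ofReal hBval

/-- Rényi privacy of the subsampled Gaussian mechanism, in dual form. -/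
lemma lintegral_mixture_le {n : ℕ} (hn : 0 < n) (a a' : Fin n → H) (i₀ : Fin n)
    (haa : ∀ i, i ≠ i₀ → a i = a' i) {α p s : ℝ} (h1 : 1 < α) (hαp : α.HolderConjugate p)
    (hs0 : 0 ≤ s) (hs : s ≤ 10 / 7)
    (hqs : (1 / n : ℝ) * α * (1 + s) * Real.exp (1.5 * (α - 1) * s) ≤ s)
    (ha : ∀ i, ‖a i₀ - a' i‖ ^ 2 ≤ s) (ha' : ∀ i, ‖a' i₀ - a' i‖ ^ 2 ≤ s)
    {g : H → ENNReal} (hg : Measurable g) :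
    ∑ i, (n : ENNReal)⁻¹ * ∫⁻ z, g (a i + z) ∂(stdGaussian H) ≤
      ENNReal.ofReal (Real.exp ((α - 1) * (1 / n : ℝ) ^ 2 * (3.5 * s))) *
        (∑ i, (n : ENNReal)⁻¹ * ∫⁻ z, g (a' i + z) ^ p ∂(stdGaussian H)) ^ (1 / p) := by
  have hn' : (0 : ℝ) < n := by exact_mod_cast hn
  let M : (Fin n → H) → H → ℝ := fun a z => ∑ i, (1 / n : ℝ) * gaussianShiftDensity (a i) z
  have hne : (Finset.univ : Finset (Fin n)).Nonempty := ⟨i₀, Finset.mem_univ _⟩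
  have hMpos : ∀ a z, 0 < M a z := fun a z =>
    Finset.sum_pos (fun i _ => mul_pos (by positivity) (gaussianShiftDensity_pos _ _)) hne
  have hMmeas : ∀ a, Measurable (M a) := fun a =>
    Finset.measurable_sum _ fun i _ => (measurable_gaussianShiftDensity _).const_mul _
  have key : ∀ (a : Fin n → H) {g : H → ENNReal}, Measurable g →
      ∑ i, (n : ENNReal)⁻¹ * ∫⁻ z, g (a i + z) ∂(stdGaussian H) =
        ∫⁻ z, ENNReal.ofReal (M a z) * g z ∂(stdGaussian H) := by
    intro a g hg
    simp_rw [lintegral_const_add_stdGaussian _ hg]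
    have hm : ∀ i, Measurable fun z => ENNReal.ofReal (gaussianShiftDensity (a i) z) * g z :=
      fun i => (measurable_gaussianShiftDensity _).ennreal_ofReal.mul hg
    simp_rw [← lintegral_const_mul _ (hm _)]
    rw [← lintegral_finsetSum _ fun i _ => (hm i).const_mul _]
    refine lintegral_congr fun z => ?_
    simp only [M]
    rw [ENNReal.ofReal_sum_of_nonneg fun i _ =>
      (mul_pos (by positivity) (gaussianShiftDensity_pos _ _)).le, Finset.sum_mul]
    refine Finset.sum_congr rfl fun i _ => ?_
    rw [ENNReal.ofReal_mul (by positivity), one_div, ENNReal.ofReal_inv_of_pos hn',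
      ENNReal.ofReal_natCast, mul_assoc]
  have hp0 : 0 < p := hαp.symm.pos
  rw [key a hg, key a' (hg.pow_const p)]
  -- Change of measure before Hölder: the two factors carry the Rényi moment and the `L^p` norm of
  -- `g` under the other mixture.
  have e1 : ∀ z, ENNReal.ofReal (M a z) * g z =
      ((fun z => ENNReal.ofReal (M a z * M a' z ^ (-(1 / p)))) *
        (fun z => ENNReal.ofReal (M a' z ^ (1 / p)) * g z)) z := by
    intro z
    simp only [Pi.mul_apply]
    rw [← mul_assoc, ← ENNReal.ofReal_mul (mul_pos (hMpos a z)
      (Real.rpow_pos_of_pos (hMpos a' z) _)).le, mul_assoc, ← Real.rpow_add (hMpos a' z)]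
    simp
  have hm1 : Measurable fun z => ENNReal.ofReal (M a z * M a' z ^ (-(1 / p))) :=
    ((hMmeas a).mul ((hMmeas a').pow_const _)).ennreal_ofReal
  have hm2 : Measurable fun z => ENNReal.ofReal (M a' z ^ (1 / p)) * g z :=
    ((hMmeas a').pow_const _).ennreal_ofReal.mul hg
  simp_rw [e1]
  refine (ENNReal.lintegral_mul_le_Lp_mul_Lq _ hαp hm1.aemeasurable hm2.aemeasurable).trans ?_
  have e2 : ∀ z, ENNReal.ofReal (M a z * M a' z ^ (-(1 / p))) ^ α =
      ENNReal.ofReal (M a z ^ α * M a' z ^ (1 - α)) := by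
    intro z
    have hp' := Real.rpow_pos_of_pos (hMpos a' z) (-(1 / p))
    rw [ENNReal.ofReal_rpow_of_pos (mul_pos (hMpos a z) hp'),
      Real.mul_rpow (hMpos a z).le hp'.le, ← Real.rpow_mul (hMpos a' z).le]
    congr 3
    have := hαp.div_conj_eq_sub_one
    rw [neg_mul, one_div_mul_eq_div, this]; ring
  have e3 : ∀ z, (ENNReal.ofReal (M a' z ^ (1 / p)) * g z) ^ p =
      ENNReal.ofReal (M a' z) * g z ^ p := by
    intro z
    rw [ENNReal.mul_rpow_of_nonneg _ _ hp0.le,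
      ENNReal.ofReal_rpow_of_pos (Real.rpow_pos_of_pos (hMpos a' z) _),
      ← Real.rpow_mul (hMpos a' z).le]
    simp [hp0.ne']
  simp_rw [e2, e3]
  gcongr
  refine (ENNReal.rpow_le_rpow (lintegral_mixture_rpow_le hn a a' i₀ haa h1 hs0 hs hqs ha ha')
    (by have := hαp.pos; positivity)).trans ?_
  have hα0 : 0 < α := by linarith
  have h0 : 0 < 1 + α * (α - 1) * (1 / n : ℝ) ^ 2 * (3.5 * s) := by
    have : 0 ≤ α - 1 := by linarith
    positivity
  rw [ENNReal.ofReal_rpow_of_pos h0]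
  refine ENNReal.ofReal_le_ofReal ?_
  calc _ ≤ Real.exp (α * (α - 1) * (1 / n : ℝ) ^ 2 * (3.5 * s)) ^ (1 / α) := by
        refine Real.rpow_le_rpow h0.le ?_ (by positivity)
        rw [add_comm]
        exact Real.add_one_le_exp _
    _ = _ := by
        rw [← Real.exp_mul]
        congr 1
        field_simp

end GaussianShift

/-! ### The subsampled Gaussian mechanism on a pair of Euclidean spaces -/

lemma lintegral_uniformOn_univ_fin {n : ℕ} (g : Fin n → ENNReal) :
    ∫⁻ i, g i ∂(uniformOn (Set.univ : Set (Fin n))) = ∑ i, (n : ENNReal)⁻¹ * g i := by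
  rw [lintegral_fintype]
  refine Finset.sum_congr rfl fun i _ => ?_
  rw [uniformOn_univ, Measure.count_singleton, mul_comm]
  simp

/-- Treating the primal and dual noises as one Gaussian on the `L²` product makes the joint
Euclidean sensitivity the relevant one; separate treatment would pay for each side. -/
lemma map_toLp_stdGaussian_prod (E F : Type*) [NormedAddCommGroup E] [InnerProductSpace ℝ E]
    [FiniteDimensional ℝ E] [MeasurableSpace E] [BorelSpace E] [NormedAddCommGroup F]
    [InnerProductSpace ℝ F] [FiniteDimensional ℝ F] [MeasurableSpace F] [BorelSpace F] :
    ((stdGaussian E).prod (stdGaussian F)).map (WithLp.toLp 2) =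
      stdGaussian (WithLp 2 (E × F)) := by
  have hm : Measurable (WithLp.toLp 2 : E × F → WithLp 2 (E × F)) := by fun_prop
  have : IsProbabilityMeasure (((stdGaussian E).prod (stdGaussian F)).map
      (WithLp.toLp 2 : E × F → WithLp 2 (E × F))) :=
    Measure.isProbabilityMeasure_map hm.aemeasurable
  refine Measure.ext_of_charFun (funext fun t => ?_)
  rw [charFun_prod, charFun_stdGaussian, charFun_stdGaussian, charFun_stdGaussian,
    ← Complex.exp_add]
  congr 1
  have h := WithLp.prod_norm_sq_eq_of_L2 t
  have h' : ((‖t‖ : ℂ)) ^ 2 = (‖t.fst‖ : ℂ) ^ 2 + (‖t.snd‖ : ℂ) ^ 2 := by exact_mod_cast h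
  rw [h']
  change -(‖t.fst‖ : ℂ) ^ 2 / 2 + -(‖t.snd‖ : ℂ) ^ 2 / 2 = _
  ring

section Step

variable {d : ℕ}

instance isProbabilityMeasure_isotropicGaussian (σsq : ℝ) :
    IsProbabilityMeasure (isotropicGaussian d σsq) :=
  Measure.isProbabilityMeasure_map (by fun_prop)

lemma lintegral_isotropicGaussian_prod (σsq : ℝ)
    {g : EuclideanSpace ℝ (Fin d) × EuclideanSpace ℝ (Fin d) → ENNReal} (hg : Measurable g) :
    ∫⁻ z, g z ∂((isotropicGaussian d σsq).prod (isotropicGaussian d σsq)) =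
      ∫⁻ z, g (√σsq • WithLp.ofLp z) ∂(stdGaussian (WithLp 2
        (EuclideanSpace ℝ (Fin d) × EuclideanSpace ℝ (Fin d)))) := by
  rw [isotropicGaussian, Measure.map_prod_map _ _ (by fun_prop) (by fun_prop),
    lintegral_map hg (by fun_prop), ← map_toLp_stdGaussian_prod,
    lintegral_map (by fun_prop) (by fun_prop)]
  rfl

/-- The law of the randomness used in one iteration: the sampled index and the two noises. -/
abbrev stepLaw (d n : ℕ) (σsq : ℝ) :
    Measure (Fin n × EuclideanSpace ℝ (Fin d) × EuclideanSpace ℝ (Fin d)) :=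
  (uniformOn (Set.univ : Set (Fin n))).prod
    ((isotropicGaussian d σsq).prod (isotropicGaussian d σsq))

/-- Dividing the centres by `√σsq` reduces this to the standard Gaussian, with squared distances at
most `s`. -/
lemma lintegral_stepLaw_le {n : ℕ} (hn : 0 < n) {σsq : ℝ} (hσ : 0 < σsq)
    (m m' : Fin n → EuclideanSpace ℝ (Fin d) × EuclideanSpace ℝ (Fin d)) (i₀ : Fin n)
    (hmm : ∀ i, i ≠ i₀ → m i = m' i) {α p s : ℝ} (h1 : 1 < α) (hαp : α.HolderConjugate p)
    (hs0 : 0 ≤ s) (hs : s ≤ 10 / 7)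
    (hqs : (1 / n : ℝ) * α * (1 + s) * Real.exp (1.5 * (α - 1) * s) ≤ s)
    (hm : ∀ i, ‖(m i₀).1 - (m' i).1‖ ^ 2 + ‖(m i₀).2 - (m' i).2‖ ^ 2 ≤ s * σsq)
    (hm' : ∀ i, ‖(m' i₀).1 - (m' i).1‖ ^ 2 + ‖(m' i₀).2 - (m' i).2‖ ^ 2 ≤ s * σsq)
    {g : EuclideanSpace ℝ (Fin d) × EuclideanSpace ℝ (Fin d) → ENNReal} (hg : Measurable g) :
    ∫⁻ w, g (m w.1 + w.2) ∂(stepLaw d n σsq) ≤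
      ENNReal.ofReal (Real.exp ((α - 1) * (1 / n : ℝ) ^ 2 * (3.5 * s))) *
        (∫⁻ w, g (m' w.1 + w.2) ^ p ∂(stepLaw d n σsq)) ^ (1 / p) := by
  have hr : 0 < √σsq := Real.sqrt_pos.2 hσ
  have key : ∀ (m : Fin n → EuclideanSpace ℝ (Fin d) × EuclideanSpace ℝ (Fin d))
      {g : EuclideanSpace ℝ (Fin d) × EuclideanSpace ℝ (Fin d) → ENNReal}, Measurable g →
      ∫⁻ w, g (m w.1 + w.2) ∂(stepLaw d n σsq) = ∑ i, (n : ENNReal)⁻¹ *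
        ∫⁻ z, g (√σsq • WithLp.ofLp ((√σsq)⁻¹ • WithLp.toLp 2 (m i) + z)) ∂(stdGaussian (WithLp 2
        (EuclideanSpace ℝ (Fin d) × EuclideanSpace ℝ (Fin d)))) := by
    intro m g hg
    have hmeas : Measurable fun w : Fin n × EuclideanSpace ℝ (Fin d) × EuclideanSpace ℝ (Fin d) =>
        g (m w.1 + w.2) :=
      hg.comp ((((measurable_of_finite m).comp measurable_fst)).add measurable_snd)
    rw [lintegral_prod _ hmeas.aemeasurable, lintegral_uniformOn_univ_fin]
    refine Finset.sum_congr rfl fun i _ => ?_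
    rw [lintegral_isotropicGaussian_prod (g := fun z => g (m i + z)) _
      (hg.comp (measurable_const_add _))]
    congr 1
    refine lintegral_congr fun z => ?_
    rw [WithLp.ofLp_add, WithLp.ofLp_smul, smul_add, smul_smul, mul_inv_cancel₀ hr.ne', one_smul]
  rw [key m hg, key m' (g := fun x => g x ^ p) (hg.pow_const p)]
  have hdist : ∀ x y : EuclideanSpace ℝ (Fin d) × EuclideanSpace ℝ (Fin d),
      ‖x.1 - y.1‖ ^ 2 + ‖x.2 - y.2‖ ^ 2 ≤ s * σsq →
      ‖(√σsq)⁻¹ • WithLp.toLp 2 x - (√σsq)⁻¹ • WithLp.toLp 2 y‖ ^ 2 ≤ s := by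
    intro x y h
    rw [← smul_sub, norm_smul, mul_pow, WithLp.prod_norm_sq_eq_of_L2, Real.norm_eq_abs, sq_abs,
      inv_pow, Real.sq_sqrt hσ.le, inv_mul_le_iff₀ hσ, mul_comm]
    exact h
  exact lintegral_mixture_le hn (fun i => (√σsq)⁻¹ • WithLp.toLp 2 (m i))
    (fun i => (√σsq)⁻¹ • WithLp.toLp 2 (m' i)) i₀ (fun i hi => by simp only [hmm i hi]) h1 hαp
    hs0 hs hqs (fun i => hdist _ _ (hm i)) (fun i => hdist _ _ (hm' i))
    (g := fun z => g (√σsq • WithLp.ofLp z)) (by fun_prop)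

end Step

/-! ### Adaptive composition -/

/-- The dual form of a bound on the Rényi divergence of `P` from `Q`: for the exponent `α`
conjugate to `p`, it says that the density of `P` has norm at most `C` in `L^α(Q)`. -/
def RenyiDual {Y : Type*} [MeasurableSpace Y] (p : ℝ) (C : ENNReal) (P Q : Measure Y) : Prop :=
  ∀ F : Y → ENNReal, Measurable F → ∫⁻ y, F y ∂P ≤ C * (∫⁻ y, F y ^ p ∂Q) ^ (1 / p)

/-- The conditional bound is itself a test function of `x`, to which the first bound applies; its
`p`-th power undoes the root `1/p`, and Fubini reassembles the integral. -/
lemma RenyiDual.comp {X W Y : Type*} [MeasurableSpace X] [MeasurableSpace W] [MeasurableSpace Y]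
    {p : ℝ} (hp : 0 < p) {C c : ENNReal} {P Q : Measure X} {μ : Measure W} [SFinite P]
    [SFinite Q] [SFinite μ] (hPQ : RenyiDual p C P Q) {Ψ Ψ' : X × W → Y} (hΨ : Measurable Ψ)
    (hΨ' : Measurable Ψ') (h : ∀ x, ∀ F : Y → ENNReal, Measurable F →
      ∫⁻ w, F (Ψ (x, w)) ∂μ ≤ c * (∫⁻ w, F (Ψ' (x, w)) ^ p ∂μ) ^ (1 / p)) :
    RenyiDual p (c * C) ((P.prod μ).map Ψ) ((Q.prod μ).map Ψ') := by
  intro F hF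
  have hm' : Measurable fun z => F (Ψ' z) ^ p := (hF.comp hΨ').pow_const p
  have hin : Measurable fun x => ∫⁻ w, F (Ψ' (x, w)) ^ p ∂μ := hm'.lintegral_prod_right'
  rw [lintegral_map hF hΨ, lintegral_map (hF.pow_const p) hΨ',
    lintegral_prod (f := fun z => F (Ψ z)) (hF.comp hΨ).aemeasurable,
    lintegral_prod (f := fun z => F (Ψ' z) ^ p) hm'.aemeasurable]
  calc ∫⁻ x, ∫⁻ w, F (Ψ (x, w)) ∂μ ∂P
      ≤ ∫⁻ x, c * (∫⁻ w, F (Ψ' (x, w)) ^ p ∂μ) ^ (1 / p) ∂P := lintegral_mono fun x => h x F hF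
    _ = c * ∫⁻ x, (∫⁻ w, F (Ψ' (x, w)) ^ p ∂μ) ^ (1 / p) ∂P :=
        lintegral_const_mul _ (hin.pow_const _)
    _ ≤ c * (C * (∫⁻ x, ((∫⁻ w, F (Ψ' (x, w)) ^ p ∂μ) ^ (1 / p)) ^ p ∂Q) ^ (1 / p)) := by
        gcongr
        exact hPQ _ (hin.pow_const _)
    _ = _ := by
        have e : ∀ y : ENNReal, (y ^ (1 / p)) ^ p = y := fun y => by
          rw [← ENNReal.rpow_mul, one_div_mul_cancel hp.ne', ENNReal.rpow_one]
        simp_rw [e]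
        rw [mul_assoc]

/-- Conversion of Rényi privacy to approximate differential privacy. -/
lemma RenyiDual.measure_le {Y : Type*} [MeasurableSpace Y] {P Q : Measure Y}
    {α p ρ δ : ℝ} (h1 : 1 < α) (hαp : α.HolderConjugate p) (hδ : 0 < δ)
    (h : RenyiDual p (ENNReal.ofReal (Real.exp ((α - 1) * ρ / α))) P Q) {φ : Y → ENNReal}
    (hφ : Measurable φ) (hφ1 : ∀ y, φ y ≤ 1) (hfin : ∫⁻ y, φ y ∂Q ≠ ⊤) :
    ∫⁻ y, φ y ∂P ≤ ENNReal.ofReal (Real.exp (ρ + Real.log (1 / δ) / (α - 1))) * ∫⁻ y, φ y ∂Q +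
      ENNReal.ofReal δ := by
  have hα0 : 0 < α := by linarith
  have hp1 : 1 < p := hαp.symm.lt
  have hp : 0 < p := hαp.symm.pos
  have hle : ∫⁻ y, φ y ^ p ∂Q ≤ ∫⁻ y, φ y ∂Q := by
    refine lintegral_mono fun y => ?_
    calc φ y ^ p ≤ φ y ^ (1 : ℝ) := ENNReal.rpow_le_rpow_of_exponent_ge (hφ1 y) hp1.le
      _ = φ y := ENNReal.rpow_one _
  have h2 := (h φ hφ).trans (mul_le_mul_right (ENNReal.rpow_le_rpow hle (by positivity)) _)
  refine h2.trans ?_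
  set b : ℝ := (∫⁻ y, φ y ∂Q).toReal with hb
  rw [← ENNReal.ofReal_toReal hfin, ← hb]
  have hb0 : 0 ≤ b := ENNReal.toReal_nonneg
  have e1p : 1 / p = (α - 1) / α := by
    have := hαp.inv_add_inv_eq_one
    rw [one_div]; field_simp
    field_simp at this
    linarith
  rw [ENNReal.ofReal_rpow_of_nonneg hb0 (by positivity), ← ENNReal.ofReal_mul (Real.exp_pos _).le,
    ← ENNReal.ofReal_mul (Real.exp_pos _).le, ← ENNReal.ofReal_add (by positivity) hδ.le, e1p]
  refine ENNReal.ofReal_le_ofReal ?_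
  have hexp : Real.exp ((α - 1) * ρ / α) = Real.exp ρ ^ ((α - 1) / α) := by
    rw [← Real.exp_mul]; ring_nf
  rw [hexp, ← Real.mul_rpow (Real.exp_pos _).le hb0]
  set x := Real.exp ρ * b with hx
  have hx0 : 0 ≤ x := by positivity
  have hα1 : 0 < α - 1 := by linarith
  have hpos : 0 ≤ Real.exp (ρ + Real.log (1 / δ) / (α - 1)) * b := by positivity
  -- Either the bound is already below `δ`, or `x ≥ δ^(α/(α-1))` and the missing factor `x^(-1/α)`
  -- is at most `δ^(-1/(α-1))`.
  rcases le_or_gt (x ^ ((α - 1) / α)) δ with hc | hc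
  · linarith
  have hxpos : 0 < x := by
    rcases hx0.eq_or_lt with h0 | h0
    · rw [← h0, Real.zero_rpow (by positivity)] at hc; linarith
    · exact h0
  have hdx : δ ^ (α / (α - 1)) ≤ x := by
    have := Real.rpow_le_rpow hδ.le hc.le (z := α / (α - 1)) (by positivity)
    rwa [← Real.rpow_mul hx0, show (α - 1) / α * (α / (α - 1)) = 1 by field_simp,
      Real.rpow_one] at this
  have e2 : Real.exp (ρ + Real.log (1 / δ) / (α - 1)) * b = x * δ ^ (-(1 / (α - 1))) := by
    rw [Real.exp_add, Real.rpow_def_of_pos hδ, one_div δ, Real.log_inv, hx]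
    ring_nf
  have e3 : x ^ ((α - 1) / α) = x * x ^ (-(1 / α)) := by
    rw [← Real.rpow_one_add' hx0]
    · congr 1; field_simp; ring
    · have : 1 + -(1 / α) = (α - 1) / α := by field_simp; ring
      rw [this]; positivity
  have h4 : x ^ (-(1 / α)) ≤ δ ^ (-(1 / (α - 1))) := by
    have := Real.rpow_le_rpow_of_nonpos (by positivity) hdx
      (show -(1 / α) ≤ 0 by rw [neg_nonpos]; positivity)
    rwa [← Real.rpow_mul hδ.le, show α / (α - 1) * -(1 / α) = -(1 / (α - 1)) by
      field_simp] at this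
  rw [e2, e3]
  have := mul_le_mul_of_nonneg_left h4 hx0
  linarith

/-- Under a product measure, a function of the first `t` coordinates is independent of
coordinate `t`. -/
lemma map_prodMk_eval_infinitePi {W X : Type*} [MeasurableSpace W] [MeasurableSpace X] [Nonempty W]
    (μ : Measure W) [IsProbabilityMeasure μ] {φ : (ℕ → W) → X} (hφ : Measurable φ) (t : ℕ)
    (hdep : ∀ c c' : ℕ → W, (∀ s < t, c s = c' s) → φ c = φ c') :
    (Measure.infinitePi fun _ : ℕ => μ).map (fun c => (φ c, c t)) =
      ((Measure.infinitePi fun _ : ℕ => μ).map φ).prod μ := by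
  classical
  obtain ⟨w₀⟩ := ‹Nonempty W›
  have hind : iIndepFun (fun (i : ℕ) (c : ℕ → W) => c i) (Measure.infinitePi fun _ : ℕ => μ) :=
    iIndepFun_infinitePi (X := fun _ w => w) fun _ => measurable_id
  have h := hind.indepFun_finset (Finset.range t) {t} (by simp) (fun i => measurable_pi_apply i)
  let ext : (Finset.range t → W) → ℕ → W := fun r s =>
    if hs : s ∈ Finset.range t then r ⟨s, hs⟩ else w₀
  have hext : Measurable ext := by
    refine measurable_pi_lambda _ fun s => ?_
    by_cases hs : s ∈ Finset.range t
    · simp only [ext, dif_pos hs]; exact measurable_pi_apply _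
    · simp only [ext, dif_neg hs]; exact measurable_const
  have hlast : Measurable fun r : (({t} : Finset ℕ) → W) => r ⟨t, Finset.mem_singleton_self t⟩ :=
    measurable_pi_apply _
  have h2 := h.comp (hφ.comp hext) hlast
  have e1 : (φ ∘ ext) ∘ (fun (c : ℕ → W) (i : Finset.range t) => c i) = φ := by
    funext c
    refine hdep _ _ fun s hs => ?_
    simp [ext, hs]
  rw [e1] at h2
  have h3 := (indepFun_iff_map_prod_eq_prod_map_map hφ.aemeasurable
    (measurable_pi_apply t).aemeasurable).1 h2
  have h4 : (Measure.infinitePi fun _ : ℕ => μ).map (fun c : ℕ → W => c t) = μ :=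
    Measure.infinitePi_map_eval _ t
  exact h3.trans (by congr 1)

/-! ### The Euclidean projection -/

section Projection

open scoped RealInnerProductSpace

variable {d : ℕ} {K : Set (EuclideanSpace ℝ (Fin d))}

lemma euclideanProj_spec (hne : K.Nonempty) (hc : IsClosed K) (hK : Convex ℝ K)
    (x : EuclideanSpace ℝ (Fin d)) :
    euclideanProj K x ∈ K ∧ ∀ z ∈ K, ⟪x - euclideanProj K x, z - euclideanProj K x⟫ ≤ 0 := by
  have hbdd : BddBelow (Set.range fun w : K => ‖x - w‖) := ⟨0, by rintro _ ⟨w, rfl⟩; simp⟩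
  have hex : ∃ y, y ∈ K ∧ ∀ z ∈ K, ‖x - y‖ ≤ ‖x - z‖ := by
    obtain ⟨v, hv, hmin⟩ := exists_norm_eq_iInf_of_complete_convex hne hc.isComplete hK x
    exact ⟨v, hv, fun z hz => hmin ▸ ciInf_le hbdd ⟨z, hz⟩⟩
  obtain ⟨h1, h2⟩ := Classical.epsilon_spec hex
  refine ⟨h1, (norm_eq_iInf_iff_real_inner_le_zero hK h1).1 ?_⟩
  have : Nonempty K := hne.to_subtype
  exact le_antisymm (le_ciInf fun w => h2 w w.2) (ciInf_le hbdd ⟨_, h1⟩)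

/-- Needed only to make the iterates measurable. -/
lemma lipschitzWith_euclideanProj (hne : K.Nonempty) (hc : IsClosed K) (hK : Convex ℝ K) :
    LipschitzWith 1 (euclideanProj K) := by
  refine LipschitzWith.of_dist_le_mul fun x y => ?_
  obtain ⟨hx, hx'⟩ := euclideanProj_spec hne hc hK x
  obtain ⟨hy, hy'⟩ := euclideanProj_spec hne hc hK y
  have h1 := hx' _ hy
  have h2 := hy' _ hx
  rw [dist_eq_norm, dist_eq_norm, NNReal.coe_one, one_mul]
  set a := euclideanProj K x
  set b := euclideanProj K y
  have h3 : ‖a - b‖ ^ 2 ≤ ⟪x - y, a - b⟫ := by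
    have e : ‖a - b‖ ^ 2 = ⟪x - y, a - b⟫ + ⟪x - a, b - a⟫ + ⟪y - b, a - b⟫ := by
      rw [← real_inner_self_eq_norm_sq]
      simp only [inner_sub_left, inner_sub_right]
      ring
    linarith
  have h4 := real_inner_le_norm (x - y) (a - b)
  by_contra hlt
  push Not at hlt
  have h0 : 0 ≤ ‖x - y‖ := norm_nonneg _
  nlinarith

end Projection

/-! ### Gradients on a convex set with interior points -/

section Gradient

variable {V : Type*} [NormedAddCommGroup V] [NormedSpace ℝ V]

/-- On a convex set with interior points, the derivative in any direction is a limit of difference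
quotients of values in the set. -/
lemma exists_tendsto_fderiv {D : Set V} (hDint : (interior D).Nonempty) (v : V) :
    ∃ z₀ ∈ D, ∃ τ : ℝ, 0 < τ ∧ z₀ + τ • v ∈ D ∧ ∀ z ∈ D, ∀ F : V → ℝ, DifferentiableAt ℝ F z →
      Filter.Tendsto (fun k : ℕ => (τ⁻¹ * (k + 1 : ℝ)) *
        (F (z + (1 / (k + 1 : ℝ)) • (z₀ + τ • v - z)) - F (z + (1 / (k + 1 : ℝ)) • (z₀ - z))))
        Filter.atTop (nhds (fderiv ℝ F z v)) := by
  obtain ⟨z₀, hz₀⟩ := hDint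
  have hz₀D := interior_subset hz₀
  have hcont : Filter.Tendsto (fun τ : ℝ => z₀ + τ • v) (nhdsWithin 0 (Set.Ioi 0)) (nhds z₀) := by
    have : Continuous fun τ : ℝ => z₀ + τ • v := by fun_prop
    have h := this.tendsto 0
    simp only [zero_smul, add_zero] at h
    exact h.mono_left nhdsWithin_le_nhds
  obtain ⟨τ, hτD, hτ⟩ := ((hcont.eventually (mem_interior_iff_mem_nhds.1 hz₀)).and
    self_mem_nhdsWithin).exists
  refine ⟨z₀, hz₀D, τ, hτ, hτD, fun z _ F hF => ?_⟩
  have hlim : ∀ u : V, Filter.Tendsto (fun k : ℕ => (k + 1 : ℝ) *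
      (F (z + (1 / (k + 1 : ℝ)) • u) - F z)) Filter.atTop (nhds (fderiv ℝ F z u)) := by
    intro u
    have h := (hF.hasFDerivAt.hasLineDerivAt u).tendsto_slope_zero
    have hk : Filter.Tendsto (fun k : ℕ => (1 / (k + 1 : ℝ))) Filter.atTop
        (nhdsWithin 0 {0}ᶜ) := by
      refine tendsto_nhdsWithin_iff.2 ⟨tendsto_one_div_add_atTop_nhds_zero_nat, ?_⟩
      exact Filter.Eventually.of_forall fun k => (by positivity : (1 / (k + 1 : ℝ)) ≠ 0)
    refine (h.comp hk).congr fun k => ?_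
    simp
  -- At a boundary point the line in direction `v` may leave `D`. Segments towards `z₀` and `z₀ + τ
  -- v` do not when `D` is convex, and their directions differ by `τ v`.
  have h := ((hlim (z₀ + τ • v - z)).sub (hlim (z₀ - z))).const_mul τ⁻¹
  rw [← map_sub, show z₀ + τ • v - z - (z₀ - z) = τ • v by abel, map_smul, smul_eq_mul,
    inv_mul_cancel_left₀ (ne_of_gt hτ)] at h
  refine h.congr fun k => ?_
  ring

lemma add_one_div_smul_sub_mem {D : Set V} (hD : Convex ℝ D) {z w : V} (hz : z ∈ D) (hw : w ∈ D)
    (k : ℕ) : z + (1 / (k + 1 : ℝ)) • (w - z) ∈ D :=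
  hD.add_smul_sub_mem hz hw ⟨by positivity, by
    rw [div_le_one (by positivity)]; linarith [(Nat.cast_nonneg k : (0 : ℝ) ≤ k)]⟩

/-- The difference quotients are continuous on `K`. Nothing is known about `F` off `D`, hence the
indicator. -/
lemma measurable_indicator_fderiv_apply [MeasurableSpace V] [BorelSpace V] {D K : Set V}
    (hD : Convex ℝ D) (hDint : (interior D).Nonempty) (hKc : IsClosed K) (hKD : K ⊆ D)
    {F : V → ℝ} (hF : ∀ z ∈ D, DifferentiableAt ℝ F z) (v : V) :
    Measurable (K.indicator fun z => fderiv ℝ F z v) := by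
  classical
  obtain ⟨z₀, hz₀, τ, hτ, hτD, hlim⟩ := exists_tendsto_fderiv hDint v
  refine measurable_of_tendsto_metrizable (f := fun k : ℕ => K.indicator fun z =>
    (τ⁻¹ * (k + 1 : ℝ)) * (F (z + (1 / (k + 1 : ℝ)) • (z₀ + τ • v - z)) -
      F (z + (1 / (k + 1 : ℝ)) • (z₀ - z)))) (fun k => ?_) (tendsto_pi_nhds.2 fun z => ?_)
  · have hcont : ∀ w ∈ D, ContinuousOn (fun z => F (z + (1 / (k + 1 : ℝ)) • (w - z))) K := by
      intro w hw z hz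
      have h1 := (hF _ (add_one_div_smul_sub_mem hD (hKD hz) hw k)).continuousAt
      have h2 : ContinuousAt (fun z => z + (1 / (k + 1 : ℝ)) • (w - z)) z := by fun_prop
      exact (h1.comp (f := fun z => z + (1 / (k + 1 : ℝ)) • (w - z)) h2).continuousWithinAt
    rw [← Set.piecewise_eq_indicator]
    exact ContinuousOn.measurable_piecewise
      (continuousOn_const.mul ((hcont _ hτD).sub (hcont _ hz₀))) continuousOn_const
      hKc.measurableSet
  · by_cases hz : z ∈ K
    · simp only [Set.indicator_of_mem hz]
      exact hlim z (hKD hz) F (hF z (hKD hz))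
    · simp only [Set.indicator_of_notMem hz]
      exact tendsto_const_nhds

/-- `N` is kept general because the product type carries the sup norm, whereas the Lipschitz bound
is Euclidean. -/
lemma abs_fderiv_apply_le {D : Set V} (hD : Convex ℝ D) (hDint : (interior D).Nonempty)
    {N : V → ℝ} (hN : ∀ (t : ℝ) (v : V), 0 ≤ t → N (t • v) = t * N v)
    {F : V → ℝ} {G : ℝ} (hLip : ∀ z ∈ D, ∀ w ∈ D, |F z - F w| ≤ G * N (z - w)) {z : V} (hz : z ∈ D)
    (hF : DifferentiableAt ℝ F z) (v : V) : |fderiv ℝ F z v| ≤ G * N v := by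
  obtain ⟨z₀, hz₀, τ, hτ, hτD, hlim⟩ := exists_tendsto_fderiv hDint v
  refine le_of_tendsto (hlim z hz F hF).abs (Filter.Eventually.of_forall fun k => ?_)
  have hk : (0 : ℝ) < k + 1 := by positivity
  have h := hLip _ (add_one_div_smul_sub_mem hD hz hτD k) _ (add_one_div_smul_sub_mem hD hz hz₀ k)
  rw [add_sub_add_left_eq_sub, ← smul_sub, show z₀ + τ • v - z - (z₀ - z) = τ • v by abel,
    smul_smul, hN _ _ (by positivity)] at h
  rw [abs_mul, abs_of_pos (by positivity)]
  refine (mul_le_mul_of_nonneg_left h (by positivity)).trans_eq ?_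
  field_simp

end Gradient

namespace DPTDInput

open scoped RealInnerProductSpace

variable {d : ℕ} {Ξ : Type*} (A : DPTDInput d Ξ)

/-- The pair of the primal and the dual partial gradient. -/
def grads (z : EuclideanSpace ℝ (Fin d) × EuclideanSpace ℝ (Fin d)) (ξ : Ξ) :
    EuclideanSpace ℝ (Fin d) × EuclideanSpace ℝ (Fin d) :=
  (A.gradθ z.1 z.2 ξ, A.gradω z.1 z.2 ξ)

lemma inner_gradθ {z : EuclideanSpace ℝ (Fin d) × EuclideanSpace ℝ (Fin d)} {ξ : Ξ}
    (h : DifferentiableAt ℝ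
      (fun w : EuclideanSpace ℝ (Fin d) × EuclideanSpace ℝ (Fin d) => A.f w.1 w.2 ξ) z)
    (v : EuclideanSpace ℝ (Fin d)) :
    ⟪(A.grads z ξ).1, v⟫ = fderiv ℝ
      (fun w : EuclideanSpace ℝ (Fin d) × EuclideanSpace ℝ (Fin d) => A.f w.1 w.2 ξ) z (v, 0) := by
  have h1 : HasFDerivAt (fun x => A.f x z.2 ξ) _ z.1 :=
    HasFDerivAt.comp (f := fun x => (x, z.2)) z.1 h.hasFDerivAt (hasFDerivAt_prodMk_left z.1 z.2)
  simp only [grads, gradθ, gradient, InnerProductSpace.toDual_symm_apply, h1.fderiv]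
  simp

lemma inner_gradω {z : EuclideanSpace ℝ (Fin d) × EuclideanSpace ℝ (Fin d)} {ξ : Ξ}
    (h : DifferentiableAt ℝ
      (fun w : EuclideanSpace ℝ (Fin d) × EuclideanSpace ℝ (Fin d) => A.f w.1 w.2 ξ) z)
    (v : EuclideanSpace ℝ (Fin d)) :
    ⟪(A.grads z ξ).2, v⟫ = fderiv ℝ
      (fun w : EuclideanSpace ℝ (Fin d) × EuclideanSpace ℝ (Fin d) => A.f w.1 w.2 ξ) z (0, v) := by
  have h1 : HasFDerivAt (fun y => A.f z.1 y ξ) _ z.2 :=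
    HasFDerivAt.comp (f := fun y => (z.1, y)) z.2 h.hasFDerivAt (hasFDerivAt_prodMk_right z.1 z.2)
  simp only [grads, gradω, gradient, InnerProductSpace.toDual_symm_apply, h1.fderiv]
  simp

variable {D : Set (EuclideanSpace ℝ (Fin d) × EuclideanSpace ℝ (Fin d))}

/-- Applying the derivative to the gradient itself gives `N ≤ G √N` for its squared norm `N`. -/
lemma norm_grads_sq_le (hD : Convex ℝ D) (hDint : (interior D).Nonempty) {ξ : Ξ}
    (hdiff : ∀ z ∈ D, DifferentiableAt ℝ
      (fun w : EuclideanSpace ℝ (Fin d) × EuclideanSpace ℝ (Fin d) => A.f w.1 w.2 ξ) z)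
    {G : ℝ} (hG : 0 < G) (hLip : ∀ z ∈ D, ∀ w ∈ D,
      |A.f z.1 z.2 ξ - A.f w.1 w.2 ξ| ≤ G * √(‖z.1 - w.1‖ ^ 2 + ‖z.2 - w.2‖ ^ 2))
    {z : EuclideanSpace ℝ (Fin d) × EuclideanSpace ℝ (Fin d)} (hz : z ∈ D) :
    ‖(A.grads z ξ).1‖ ^ 2 + ‖(A.grads z ξ).2‖ ^ 2 ≤ G ^ 2 := by
  have h := abs_fderiv_apply_le hD hDint (N := fun v => √(‖v.1‖ ^ 2 + ‖v.2‖ ^ 2))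
    (fun t v ht => by
      simp only [Prod.smul_fst, Prod.smul_snd, norm_smul, mul_pow, Real.norm_eq_abs, sq_abs]
      rw [← mul_add, Real.sqrt_mul (sq_nonneg t), Real.sqrt_sq ht])
    (F := fun w => A.f w.1 w.2 ξ) hLip hz (hdiff z hz) (A.grads z ξ)
  have e : fderiv ℝ
      (fun w : EuclideanSpace ℝ (Fin d) × EuclideanSpace ℝ (Fin d) => A.f w.1 w.2 ξ) z
      (A.grads z ξ) = ‖(A.grads z ξ).1‖ ^ 2 + ‖(A.grads z ξ).2‖ ^ 2 := by
    rw [← real_inner_self_eq_norm_sq, ← real_inner_self_eq_norm_sq, A.inner_gradθ (hdiff z hz),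
      A.inner_gradω (hdiff z hz), ← map_add]
    simp
  rw [e, abs_of_nonneg (by positivity)] at h
  set N := ‖(A.grads z ξ).1‖ ^ 2 + ‖(A.grads z ξ).2‖ ^ 2
  have hN : 0 ≤ N := by positivity
  have hs := Real.sq_sqrt hN
  have hs0 := Real.sqrt_nonneg N
  rcases hs0.eq_or_lt with h0 | h0
  · have h2 : √N ^ 2 = 0 := by rw [← h0]; norm_num
    linarith [sq_nonneg G]
  · have : √N ≤ G := by nlinarith
    nlinarith

lemma measurable_indicator_grads (hD : Convex ℝ D) (hDint : (interior D).Nonempty)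
    {K : Set (EuclideanSpace ℝ (Fin d) × EuclideanSpace ℝ (Fin d))} (hKc : IsClosed K)
    (hKD : K ⊆ D) {ξ : Ξ} (hdiff : ∀ z ∈ D, DifferentiableAt ℝ
      (fun w : EuclideanSpace ℝ (Fin d) × EuclideanSpace ℝ (Fin d) => A.f w.1 w.2 ξ) z) :
    Measurable (K.indicator fun z => A.grads z ξ) := by
  let b := EuclideanSpace.basisFun (Fin d) ℝ
  have h := measurable_indicator_fderiv_apply hD hDint hKc hKD hdiff
  have e : (K.indicator fun z => A.grads z ξ) = fun z =>
      (∑ i, (K.indicator (fun z => fderiv ℝ (fun w : EuclideanSpace ℝ (Fin d) ×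
          EuclideanSpace ℝ (Fin d) => A.f w.1 w.2 ξ) z (b i, 0)) z) • b i,
        ∑ i, (K.indicator (fun z => fderiv ℝ (fun w : EuclideanSpace ℝ (Fin d) ×
          EuclideanSpace ℝ (Fin d) => A.f w.1 w.2 ξ) z (0, b i)) z) • b i) := by
    funext z
    by_cases hz : z ∈ K
    · simp only [Set.indicator_of_mem hz]
      simp_rw [← A.inner_gradθ (hdiff z (hKD hz)), ← A.inner_gradω (hdiff z (hKD hz))]
      have hc : ∀ i x, ⟪x, b i⟫ = ⟪b i, x⟫ := fun i x => real_inner_comm _ _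
      simp_rw [hc]
      rw [b.sum_repr', b.sum_repr']
    · simp only [Set.indicator_of_notMem hz, zero_smul, Finset.sum_const_zero]
      rfl
  rw [e]
  exact (Finset.measurable_sum _ fun i _ => (h _).smul_const _).prodMk
    (Finset.measurable_sum _ fun i _ => (h _).smul_const _)

end DPTDInput

/-! ### The iterates and the releases as functions of the history of releases -/

/-- A pair of a primal and a dual vector. -/
abbrev PrimalDual (d : ℕ) : Type := EuclideanSpace ℝ (Fin d) × EuclideanSpace ℝ (Fin d)

namespace DPTDInput

variable {d n : ℕ} {Ξ : Type*} (A : DPTDInput d Ξ)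

/-- The iterates `(θ_t, ω_t)` as functions of the sequence of released gradient estimators. -/
def iter (h : ℕ → PrimalDual d) : ℕ → PrimalDual d
  | 0 => (A.θ₀, A.ω₀)
  | t + 1 =>
    ((iter h t).1 + A.ν t • (euclideanProj A.Θset ((iter h t).1 - A.κ • (h t).1) - (iter h t).1),
      (iter h t).2 + A.ν t • (euclideanProj A.Ωset ((iter h t).2 + A.η • (h t).2) - (iter h t).2))

/-- The part of the gradient estimators that is carried over from the previous release. -/
def carry (h : ℕ → PrimalDual d) : ℕ → PrimalDual d
  | 0 => 0
  | t + 1 => ((1 - A.α * A.ν t) • (h t).1, (1 - A.β * A.ν t) • (h t).2)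

/-- The weight of the fresh gradient at time `t`, for the momentum parameter `a`. -/
def freshWeight (a : ℝ) : ℕ → ℝ
  | 0 => 1
  | t + 1 => a * A.ν t

/-- The noiseless gradient estimators at time `t`, given the history and the sampled data point. -/
def stepMean (h : ℕ → PrimalDual d) (ξ : Ξ) (t : ℕ) : PrimalDual d :=
  A.carry h t + (A.freshWeight A.α t • (A.grads (A.iter h t) ξ).1,
    A.freshWeight A.β t • (A.grads (A.iter h t) ξ).2)

/-- The history after one more iteration. -/
def extend (S : Fin n → Ξ) (t : ℕ) (x : (ℕ → PrimalDual d) × Fin n × PrimalDual d) :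
    ℕ → PrimalDual d :=
  Function.update x.1 t (A.stepMean x.1 (S x.2.1) t + x.2.2)

/-- The gradient estimators released before time `t`, followed by zeros. -/
def history (S : Fin n → Ξ) (c : ℕ → Fin n × PrimalDual d) : ℕ → ℕ → PrimalDual d
  | 0 => 0
  | t + 1 => A.extend S t (history S c t, c t)

variable {A}

lemma iter_congr {h h' : ℕ → PrimalDual d} {t : ℕ} (hh : ∀ s < t, h s = h' s) :
    A.iter h t = A.iter h' t := by
  induction t with
  | zero => rfl
  | succ t ih =>
    simp only [iter, ih fun s hs => hh s (hs.trans t.lt_succ_self), hh t t.lt_succ_self]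

lemma history_apply_of_lt (S : Fin n → Ξ) (c : ℕ → Fin n × PrimalDual d) {s t : ℕ} (hst : s < t) :
    A.history S c t s = A.history S c (s + 1) s := by
  induction t, hst using Nat.le_induction with
  | base => rfl
  | succ t ht ih =>
    rw [← ih, history, extend, Function.update_of_ne (Nat.ne_of_lt ht)]

lemma history_congr (S : Fin n → Ξ) {c c' : ℕ → Fin n × PrimalDual d} {t : ℕ}
    (hc : ∀ s < t, c s = c' s) : A.history S c t = A.history S c' t := by
  induction t with
  | zero => rfl
  | succ t ih =>
    rw [history, history, ih fun s hs => hc s (hs.trans t.lt_succ_self), hc t t.lt_succ_self]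

/-- This exhibits the algorithm as an adaptive composition: the data enter only through the fresh
gradient, the iterates being functions of past releases. -/
lemma dptdState_eq_history (S : Fin n → Ξ) (c : ℕ → Fin n × PrimalDual d) (t : ℕ) :
    dptdState A (fun s => S (c s).1) (fun s => (c s).2.1) (fun s => (c s).2.2) t =
      { θ := (A.iter (A.history S c t) t).1
        ω := (A.iter (A.history S c t) t).2
        p := (A.history S c (t + 1) t).1
        q := (A.history S c (t + 1) t).2 } := by
  induction t with
  | zero =>
    simp [dptdState, history, extend, iter, stepMean, carry, freshWeight, grads]
  | succ t ih =>
    have h1 : A.iter (A.history S c (t + 1)) t = A.iter (A.history S c t) t :=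
      iter_congr fun s hs => by rw [history_apply_of_lt S c (hs.trans t.lt_succ_self),
        history_apply_of_lt S c hs]
    have h2 : A.iter (A.history S c (t + 1)) (t + 1) =
        ((A.iter (A.history S c t) t).1 + A.ν t • (euclideanProj A.Θset
          ((A.iter (A.history S c t) t).1 - A.κ • (A.history S c (t + 1) t).1) -
            (A.iter (A.history S c t) t).1),
        (A.iter (A.history S c t) t).2 + A.ν t • (euclideanProj A.Ωset
          ((A.iter (A.history S c t) t).2 + A.η • (A.history S c (t + 1) t).2) -
            (A.iter (A.history S c t) t).2)) := by
      conv_lhs => rw [iter]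
      rw [h1]
    have h3 : A.history S c (t + 1 + 1) (t + 1) =
        A.stepMean (A.history S c (t + 1)) (S (c (t + 1)).1) (t + 1) + (c (t + 1)).2 := by
      rw [history, extend, Function.update_self]
    rw [dptdState, ih, h3, stepMean, h2]
    simp [carry, freshWeight, grads]

lemma dptdRun_eq_history {T : ℕ} (S : Fin n → Ξ) (c : DPTDCoins d n T) (t : ℕ) :
    dptdRun A S c t =
      { θ := (A.iter (A.history S c.1 t) t).1
        ω := (A.iter (A.history S c.1 t) t).2
        p := (A.history S c.1 (t + 1) t).1
        q := (A.history S c.1 (t + 1) t).2 } :=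
  dptdState_eq_history S c.1 t

/-- The releases and the output, as a function of the history and of the output time. -/
def publish (A : DPTDInput d Ξ) (T : ℕ) (x : (ℕ → PrimalDual d) × Fin T) :
    (Fin T → PrimalDual d) × PrimalDual d :=
  (fun t => x.1 t, A.iter x.1 x.2)

lemma releases_output_eq_publish {T : ℕ} (S : Fin n → Ξ) (c : DPTDCoins d n T) :
    (dptdReleases A S c, dptdOutput A S c) = A.publish T (A.history S c.1 T, c.2) := by
  refine Prod.ext (funext fun t => ?_) ?_
  · simp only [dptdReleases, publish, dptdRun_eq_history, history_apply_of_lt S c.1 t.2]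
  · simp only [dptdOutput, publish, dptdRun_eq_history]
    exact iter_congr fun s hs => by
      rw [history_apply_of_lt S c.1 hs, history_apply_of_lt S c.1 (hs.trans c.2.2)]

lemma iter_mem_prod (hν : ∀ t, 0 < A.ν t) (hν1 : ∀ t, A.ν t ≤ 1) (hθ₀ : A.θ₀ ∈ A.Θset)
    (hω₀ : A.ω₀ ∈ A.Ωset) (hΘc : IsClosed A.Θset) (hΘ : Convex ℝ A.Θset)
    (hΩc : IsClosed A.Ωset) (hΩ : Convex ℝ A.Ωset) (h : ℕ → PrimalDual d) (t : ℕ) :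
    A.iter h t ∈ A.Θset ×ˢ A.Ωset := by
  induction t with
  | zero => exact ⟨hθ₀, hω₀⟩
  | succ t ih =>
    exact ⟨hΘ.add_smul_sub_mem ih.1 (euclideanProj_spec ⟨_, hθ₀⟩ hΘc hΘ _).1 ⟨(hν t).le, hν1 t⟩,
      hΩ.add_smul_sub_mem ih.2 (euclideanProj_spec ⟨_, hω₀⟩ hΩc hΩ _).1 ⟨(hν t).le, hν1 t⟩⟩

lemma measurable_iter (hθ₀ : A.θ₀ ∈ A.Θset) (hω₀ : A.ω₀ ∈ A.Ωset) (hΘc : IsClosed A.Θset)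
    (hΘ : Convex ℝ A.Θset) (hΩc : IsClosed A.Ωset) (hΩ : Convex ℝ A.Ωset) (t : ℕ) :
    Measurable fun h : ℕ → PrimalDual d => A.iter h t := by
  have h1 : Measurable (euclideanProj A.Θset) :=
    (lipschitzWith_euclideanProj ⟨_, hθ₀⟩ hΘc hΘ).continuous.measurable
  have h2 : Measurable (euclideanProj A.Ωset) :=
    (lipschitzWith_euclideanProj ⟨_, hω₀⟩ hΩc hΩ).continuous.measurable
  induction t with
  | zero => exact measurable_const
  | succ t ih =>
    simp only [iter]
    fun_prop

/-- What the privacy analysis needs to know about the gradients at the iterates. -/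
structure GradsBound (A : DPTDInput d Ξ) (G : ℝ) : Prop where
  measurable_iter : ∀ t, Measurable fun h : ℕ → PrimalDual d => A.iter h t
  measurable_grads : ∀ t ξ, Measurable fun h : ℕ → PrimalDual d => A.grads (A.iter h t) ξ
  norm_sq_le : ∀ h t ξ,
    ‖(A.grads (A.iter h t) ξ).1‖ ^ 2 + ‖(A.grads (A.iter h t) ξ).2‖ ^ 2 ≤ G ^ 2
  weight_mem : ∀ t, A.freshWeight A.α t ∈ Set.Icc 0 1 ∧ A.freshWeight A.β t ∈ Set.Icc 0 1

variable {G : ℝ}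

lemma GradsBound.measurable_stepMean (hA : A.GradsBound G) (ξ : Ξ) (t : ℕ) :
    Measurable fun h : ℕ → PrimalDual d => A.stepMean h ξ t := by
  have h1 : Measurable fun h : ℕ → PrimalDual d => A.carry h t := by
    cases t with
    | zero => exact measurable_const
    | succ t => simp only [carry]; fun_prop
  have h2 := hA.measurable_grads t ξ
  have h3 : Measurable fun h : ℕ → PrimalDual d =>
      A.freshWeight A.α t • (A.grads (A.iter h t) ξ).1 :=
    h2.fst.const_smul (A.freshWeight A.α t)
  have h4 : Measurable fun h : ℕ → PrimalDual d =>
      A.freshWeight A.β t • (A.grads (A.iter h t) ξ).2 :=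
    h2.snd.const_smul (A.freshWeight A.β t)
  exact h1.add (h3.prodMk h4)

lemma GradsBound.measurable_extend (hA : A.GradsBound G) (S : Fin n → Ξ) (t : ℕ) :
    Measurable (A.extend S t) := by
  have h1 : Measurable fun x : (ℕ → PrimalDual d) × Fin n => A.stepMean x.1 (S x.2) t :=
    measurable_from_prod_countable_left fun i => hA.measurable_stepMean (S i) t
  have h2 : Measurable fun x : (ℕ → PrimalDual d) × Fin n × PrimalDual d => (x.1, x.2.1) :=
    measurable_fst.prodMk measurable_snd.fst
  have h3 : Measurable fun x : (ℕ → PrimalDual d) × Fin n × PrimalDual d =>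
      (x.1, A.stepMean x.1 (S x.2.1) t + x.2.2) :=
    measurable_fst.prodMk ((h1.comp h2).add measurable_snd.snd)
  exact (measurable_update' (X := fun _ : ℕ => PrimalDual d) (a := t)).comp h3

lemma GradsBound.measurable_history (hA : A.GradsBound G) (S : Fin n → Ξ) (t : ℕ) :
    Measurable fun c : ℕ → Fin n × PrimalDual d => A.history S c t := by
  induction t with
  | zero => exact measurable_const
  | succ t ih =>
    simp only [history]
    exact (hA.measurable_extend S t).comp (ih.prodMk (measurable_pi_apply t))

lemma GradsBound.measurable_publish (hA : A.GradsBound G) (T : ℕ) :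
    Measurable (A.publish T) := by
  have h1 : Measurable fun x : (ℕ → PrimalDual d) × Fin T => A.iter x.1 x.2 :=
    measurable_from_prod_countable_left fun i => hA.measurable_iter i
  unfold publish
  refine Measurable.prodMk (measurable_pi_lambda _ fun t => ?_) h1
  fun_prop

lemma norm_smul_sub_smul_sq_le {E : Type*} [NormedAddCommGroup E] [InnerProductSpace ℝ E]
    {w : ℝ} (hw : w ∈ Set.Icc (0 : ℝ) 1) (x y : E) :
    ‖w • x - w • y‖ ^ 2 ≤ 2 * ‖x‖ ^ 2 + 2 * ‖y‖ ^ 2 := by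
  have h1 : w ^ 2 ≤ 1 := by nlinarith [hw.1, hw.2]
  have h2 := parallelogram_law_with_norm ℝ x y
  have h3 : ‖x - y‖ ^ 2 ≤ 2 * ‖x‖ ^ 2 + 2 * ‖y‖ ^ 2 := by nlinarith [mul_self_nonneg ‖x + y‖]
  rw [← smul_sub, norm_smul, mul_pow, Real.norm_eq_abs, sq_abs]
  nlinarith [sq_nonneg ‖x - y‖]

/-- The sensitivity of one iteration. -/
lemma GradsBound.stepMean_sub_le (hA : A.GradsBound G) (h : ℕ → PrimalDual d) (ξ ξ' : Ξ) (t : ℕ) :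
    ‖(A.stepMean h ξ t).1 - (A.stepMean h ξ' t).1‖ ^ 2 +
      ‖(A.stepMean h ξ t).2 - (A.stepMean h ξ' t).2‖ ^ 2 ≤ 4 * G ^ 2 := by
  -- The carried-over part depends on the history alone and cancels.
  simp only [stepMean, Prod.fst_add, Prod.snd_add, add_sub_add_left_eq_sub]
  have h1 := norm_smul_sub_smul_sq_le (hA.weight_mem t).1 (A.grads (A.iter h t) ξ).1
    (A.grads (A.iter h t) ξ').1
  have h2 := norm_smul_sub_smul_sq_le (hA.weight_mem t).2 (A.grads (A.iter h t) ξ).2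
    (A.grads (A.iter h t) ξ').2
  linarith [hA.norm_sq_le h t ξ, hA.norm_sq_le h t ξ']

/-! ### Rényi bound for the law of the history -/

/-- The law of the history before time `t`. -/
def historyLaw (A : DPTDInput d Ξ) (σsq : ℝ) (S : Fin n → Ξ) (t : ℕ) :
    Measure (ℕ → PrimalDual d) :=
  (Measure.infinitePi fun _ : ℕ => stepLaw d n σsq).map fun c => A.history S c t

lemma GradsBound.historyLaw_succ (hA : A.GradsBound G) [Nonempty (Fin n)] (σsq : ℝ)
    (S : Fin n → Ξ) (t : ℕ) :
    A.historyLaw σsq S (t + 1) =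
      ((A.historyLaw σsq S t).prod (stepLaw d n σsq)).map (A.extend S t) := by
  rw [historyLaw, historyLaw, ← map_prodMk_eval_infinitePi (stepLaw d n σsq)
    (hA.measurable_history S t) t fun c c' hc => history_congr S hc,
    Measure.map_map (hA.measurable_extend S t)
      ((hA.measurable_history S t).prodMk (measurable_pi_apply t))]
  rfl

/-- Induction on `t`: for each fixed past the next release is a mixture step, and the logarithms of
the constants add. -/
lemma GradsBound.renyiDual_historyLaw (hA : A.GradsBound G) (hn : 0 < n) {σsq : ℝ} (hσ : 0 < σsq)
    {S S' : Fin n → Ξ} (hS : Neighbouring S S') {α p s : ℝ} (h1 : 1 < α)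
    (hαp : α.HolderConjugate p) (hs0 : 0 ≤ s) (hs : s ≤ 10 / 7)
    (hqs : (1 / n : ℝ) * α * (1 + s) * Real.exp (1.5 * (α - 1) * s) ≤ s)
    (hGs : 4 * G ^ 2 ≤ s * σsq) (t : ℕ) :
    RenyiDual p (ENNReal.ofReal (Real.exp (t * ((α - 1) * (1 / n : ℝ) ^ 2 * (3.5 * s)))))
      (A.historyLaw σsq S t) (A.historyLaw σsq S' t) := by
  have : Nonempty (Fin n) := ⟨⟨0, hn⟩⟩
  have hp : 0 < p := hαp.symm.pos
  have hprob : ∀ (S : Fin n → Ξ) t, IsProbabilityMeasure (A.historyLaw σsq S t) := fun S t =>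
    Measure.isProbabilityMeasure_map (hA.measurable_history S t).aemeasurable
  obtain ⟨i₀, -, hi₀⟩ := hS
  induction t with
  | zero =>
    intro F hF
    simp [historyLaw, history, ← ENNReal.rpow_mul, hp.ne']
  | succ t ih =>
    have := hprob S t
    have := hprob S' t
    rw [hA.historyLaw_succ, hA.historyLaw_succ]
    have h := ih.comp hp (μ := stepLaw d n σsq) (hA.measurable_extend S t)
      (hA.measurable_extend S' t)
      (c := ENNReal.ofReal (Real.exp ((α - 1) * (1 / n : ℝ) ^ 2 * (3.5 * s))))
      (fun x F hF => by
        have hu : Measurable fun y : PrimalDual d => F (Function.update x t y) :=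
          hF.comp (measurable_update x)
        exact lintegral_stepLaw_le hn hσ (fun i => A.stepMean x (S i) t)
          (fun i => A.stepMean x (S' i) t) i₀
          (fun i hi => by
            have : S i = S' i := by
              by_contra hne
              exact hi (hi₀ i hne)
            simp only [this])
          h1 hαp hs0 hs hqs (fun i => (hA.stepMean_sub_le x _ _ t).trans hGs)
          (fun i => (hA.stepMean_sub_le x _ _ t).trans hGs) hu)
    rw [← ENNReal.ofReal_mul (Real.exp_pos _).le, ← Real.exp_add] at h
    convert h using 3
    push_cast
    ring

end DPTDInput

/-! ### Privacy of the releases and of the output -/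

lemma IsDP.map {X C Y Z : Type*} [MeasurableSpace C] [MeasurableSpace Y] [MeasurableSpace Z]
    {adj : X → X → Prop} {P : Measure C} {M : X → C → Y} {ε δ : ℝ} (h : IsDP adj P M ε δ)
    {φ : Y → Z} (hφ : Measurable φ) : IsDP adj P (fun x c => φ (M x c)) ε δ :=
  ⟨fun x => hφ.comp (h.1 x), fun x x' hx B hB => h.2 x x' hx (φ ⁻¹' B) (hφ hB)⟩

namespace DPTDInput

variable {d n : ℕ} {Ξ : Type*} {A : DPTDInput d Ξ} {G : ℝ}

lemma GradsBound.measurable_releases_output (hA : A.GradsBound G) (T : ℕ) (S : Fin n → Ξ) :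
    Measurable fun c : DPTDCoins d n T => (dptdReleases A S c, dptdOutput A S c) := by
  simp_rw [releases_output_eq_publish]
  exact (hA.measurable_publish T).comp
    (((hA.measurable_history S T).comp measurable_fst).prodMk measurable_snd)

/-- Averaging over the independent output time turns an event into a `[0, 1]`-valued function of the
history, which is why `RenyiDual.measure_le` treats functions rather than sets. -/
lemma GradsBound.dptdCoinLaw_preimage (hA : A.GradsBound G) (hn : 0 < n) {T : ℕ} (hT : 0 < T)
    (σsq : ℝ) (S : Fin n → Ξ) {B : Set ((Fin T → PrimalDual d) × PrimalDual d)}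
    (hB : MeasurableSet B) :
    dptdCoinLaw d n T σsq ((fun c => (dptdReleases A S c, dptdOutput A S c)) ⁻¹' B) =
      ∫⁻ h, uniformOn (Set.univ : Set (Fin T)) (Prod.mk h ⁻¹' (A.publish T ⁻¹' B))
        ∂(A.historyLaw σsq S T) := by
  have : Nonempty (Fin n) := ⟨⟨0, hn⟩⟩
  have : Nonempty (Fin T) := ⟨⟨0, hT⟩⟩
  have hm := hA.measurable_publish T hB
  rw [historyLaw, lintegral_map (measurable_measure_prodMk_left hm) (hA.measurable_history S T),
    dptdCoinLaw, Measure.prod_apply (hA.measurable_releases_output T S hB)]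
  refine lintegral_congr fun c => ?_
  congr 1
  ext τ
  simp only [Set.mem_preimage, releases_output_eq_publish]

lemma GradsBound.isDP_of_one_le (hA : A.GradsBound G) (hn : 0 < n) {T : ℕ} (hT : 0 < T)
    (σsq ε : ℝ) {δ : ℝ} (hδ : 1 ≤ δ) :
    IsDP (Neighbouring (Ξ := Ξ) (n := n)) (dptdCoinLaw d n T σsq)
      (fun S c => (dptdReleases A S c, dptdOutput A S c)) ε δ := by
  have : Nonempty (Fin n) := ⟨⟨0, hn⟩⟩
  have : Nonempty (Fin T) := ⟨⟨0, hT⟩⟩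
  have : IsProbabilityMeasure (dptdCoinLaw d n T σsq) := by unfold dptdCoinLaw; infer_instance
  refine ⟨hA.measurable_releases_output T, fun S S' _ B _ => ?_⟩
  calc _ ≤ (1 : ENNReal) := prob_le_one
    _ ≤ ENNReal.ofReal δ := by rw [← ENNReal.ofReal_one]; exact ENNReal.ofReal_le_ofReal hδ
    _ ≤ _ := le_add_self

lemma GradsBound.isDP (hA : A.GradsBound G) (hn : 0 < n) {T : ℕ} (hT : 0 < T)
    {σsq : ℝ} (hσ : 0 < σsq) {α s δ : ℝ} (hδ : 0 < δ) (h1 : 1 < α) (hs0 : 0 ≤ s) (hs : s ≤ 10 / 7)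
    (hqs : (1 / n : ℝ) * α * (1 + s) * Real.exp (1.5 * (α - 1) * s) ≤ s)
    (hGs : 4 * G ^ 2 ≤ s * σsq) :
    IsDP (Neighbouring (Ξ := Ξ) (n := n)) (dptdCoinLaw d n T σsq)
      (fun S c => (dptdReleases A S c, dptdOutput A S c))
      (3.5 * T * α * s / n ^ 2 + Real.log (1 / δ) / (α - 1)) δ := by
  have : Nonempty (Fin n) := ⟨⟨0, hn⟩⟩
  have : Nonempty (Fin T) := ⟨⟨0, hT⟩⟩
  refine ⟨hA.measurable_releases_output T, fun S S' hS B hB => ?_⟩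
  have hαp := Real.HolderConjugate.conjExponent h1
  have h := hA.renyiDual_historyLaw hn hσ hS h1 hαp hs0 hs hqs hGs T
  have e : T * ((α - 1) * (1 / n : ℝ) ^ 2 * (3.5 * s)) =
      (α - 1) * (3.5 * T * α * s / n ^ 2) / α := by
    have : α ≠ 0 := by linarith
    field_simp
  rw [e] at h
  have : IsProbabilityMeasure (A.historyLaw σsq S' T) :=
    Measure.isProbabilityMeasure_map (hA.measurable_history S' T).aemeasurable
  rw [hA.dptdCoinLaw_preimage hn hT σsq S hB, hA.dptdCoinLaw_preimage hn hT σsq S' hB]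
  refine h.measure_le h1 hαp hδ (measurable_measure_prodMk_left (hA.measurable_publish T hB))
    (fun y => prob_le_one) (ne_top_of_le_ne_top ENNReal.one_ne_top ?_)
  calc _ ≤ ∫⁻ _, 1 ∂(A.historyLaw σsq S' T) := lintegral_mono fun y => prob_le_one
    _ = 1 := by simp

lemma gradsBound (hν : ∀ t, 0 < A.ν t) (hα : 0 < A.α) (hβ : 0 < A.β)
    (hθ₀ : A.θ₀ ∈ A.Θset) (hω₀ : A.ω₀ ∈ A.Ωset)
    (hαν : ∀ t, A.α * A.ν t ≤ 1) (hβν : ∀ t, A.β * A.ν t ≤ 1)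
    (hΘc : IsClosed A.Θset) (hΘ : Convex ℝ A.Θset)
    (hΩc : IsClosed A.Ωset) (hΩ : Convex ℝ A.Ωset) {D : Set (PrimalDual d)}
    (hD : Convex ℝ D) (hDint : (interior D).Nonempty) (hDsub : A.Θset ×ˢ A.Ωset ⊆ D)
    (hDν : D = Set.univ ∨ ∀ t, A.ν t ≤ 1)
    (hdiff : ∀ ξ, ∀ z ∈ D, DifferentiableAt ℝ (fun w : PrimalDual d => A.f w.1 w.2 ξ) z)
    (hG : 0 < G) (hLip : ∀ ξ, ∀ z ∈ D, ∀ w ∈ D,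
      |A.f z.1 z.2 ξ - A.f w.1 w.2 ξ| ≤ G * √(‖z.1 - w.1‖ ^ 2 + ‖z.2 - w.2‖ ^ 2)) :
    A.GradsBound G := by
  -- A step with `ν t > 1` may leave the feasible sets, which is harmless only if `D` is everything.
  obtain ⟨K, hKc, hKD, hK⟩ : ∃ K : Set (PrimalDual d), IsClosed K ∧ K ⊆ D ∧
      ∀ h t, A.iter h t ∈ K := by
    rcases hDν with rfl | hν1
    · exact ⟨Set.univ, isClosed_univ, subset_rfl, fun _ _ => Set.mem_univ _⟩
    · exact ⟨A.Θset ×ˢ A.Ωset, hΘc.prod hΩc, hDsub,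
        iter_mem_prod hν hν1 hθ₀ hω₀ hΘc hΘ hΩc hΩ⟩
  have hiter := measurable_iter hθ₀ hω₀ hΘc hΘ hΩc hΩ
  refine ⟨hiter, fun t ξ => ?_, fun h t ξ => A.norm_grads_sq_le hD hDint (hdiff ξ) hG (hLip ξ)
    (hKD (hK h t)), fun t => ?_⟩
  · have h := (A.measurable_indicator_grads hD hDint hKc hKD (hdiff ξ)).comp (hiter t)
    have e : (fun h => A.grads (A.iter h t) ξ) =
        (K.indicator fun z => A.grads z ξ) ∘ fun h => A.iter h t :=
      funext fun x => (Set.indicator_of_mem (hK x t) fun z => A.grads z ξ).symm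
    rwa [e]
  · cases t with
    | zero => simp [freshWeight]
    | succ t => exact ⟨⟨(mul_pos hα (hν t)).le, hαν t⟩, ⟨(mul_pos hβ (hν t)).le, hβν t⟩⟩

end DPTDInput

end

theorem theorem5p1 {𝒮 𝒜 : Type*} {d : ℕ} (A : DPTDInput d (𝒮 × 𝒜 × 𝒮))
    -- the inputs of the algorithm
    (hν : ∀ t, 0 < A.ν t) (hκ : 0 < A.κ) (hη : 0 < A.η) (hα : 0 < A.α) (hβ : 0 < A.β)
    (hθ₀ : A.θ₀ ∈ A.Θset) (hω₀ : A.ω₀ ∈ A.Ωset)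
    (hαν : ∀ t, A.α * A.ν t ≤ 1) (hβν : ∀ t, A.β * A.ν t ≤ 1)
    -- closed convex feasible sets
    (hΘc : IsClosed A.Θset) (hΘ : Convex ℝ A.Θset)
    (hΩc : IsClosed A.Ωset) (hΩ : Convex ℝ A.Ωset)
    -- `f` is differentiable and `G`-Lipschitz in `(θ, ω)` on a parameter domain `D`
    (D : Set (EuclideanSpace ℝ (Fin d) × EuclideanSpace ℝ (Fin d)))
    (hD : Convex ℝ D) (hDint : (interior D).Nonempty) (hDsub : A.Θset ×ˢ A.Ωset ⊆ D)
    (hDν : D = Set.univ ∨ ∀ t, A.ν t ≤ 1)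
    (hdiff : ∀ ξ, ∀ z ∈ D, DifferentiableAt ℝ
      (fun w : EuclideanSpace ℝ (Fin d) × EuclideanSpace ℝ (Fin d) => A.f w.1 w.2 ξ) z)
    (G : ℝ) (hG : 0 < G)
    (hLip : ∀ ξ, ∀ z ∈ D, ∀ w ∈ D,
      |A.f z.1 z.2 ξ - A.f w.1 w.2 ξ| ≤ G * √(‖z.1 - w.1‖ ^ 2 + ‖z.2 - w.2‖ ^ 2))
    -- trajectory length, number of iterations, privacy parameters
    (n T : ℕ) (hn : 0 < n) (hT : 0 < T)
    (ε δ β' : ℝ) (hε : 0 < ε) (hδ : 0 < δ) (hβ' : β' ∈ Set.Ioo (0 : ℝ) 1)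
    (α' σsq σsq' : ℝ)
    (hα' : α' = Real.log (1 / δ) / ((1 - β') * ε) + 1)
    (hσ : σsq = 14 * G ^ 2 * T * α' / ((n : ℝ) ^ 2 * (β' * ε)))
    (hσ' : σsq' = σsq / (4 * G ^ 2))
    (hσ'_ge : 0.7 ≤ σsq')
    (hα'_le : α' ≤ 2 * σsq' * Real.log (n / (α' * (1 + σsq'))) / 3 + 1) :
    -- the two expressions for the noise variance agree
    (δ ≠ 1 →
      σsq = 14 * G ^ 2 * T * α' / ((n : ℝ) ^ 2 * (ε - Real.log (1 / δ) / (α' - 1)))) ∧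
    -- the output is private
    IsDP (Neighbouring (Ξ := 𝒮 × 𝒜 × 𝒮) (n := n)) (dptdCoinLaw d n T σsq)
      (fun S c => dptdOutput A S c) ε δ ∧
    -- and so is the output together with all released gradient estimators
    IsDP (Neighbouring (Ξ := 𝒮 × 𝒜 × 𝒮) (n := n)) (dptdCoinLaw d n T σsq)
      (fun S c => (dptdReleases A S c, dptdOutput A S c)) ε δ := by
  obtain ⟨hβ0, hβ1⟩ := hβ'
  have hn' : (0 : ℝ) < n := by exact_mod_cast hn
  have hA : A.GradsBound G := DPTDInput.gradsBound hν hα hβ hθ₀ hω₀ hαν hβν hΘc hΘ hΩc hΩ hD hDint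
    hDsub hDν hdiff hG hLip
  have hβε : 0 < (1 - β') * ε := mul_pos (by linarith) hε
  have hdiv : Real.log (1 / δ) ≠ 0 → Real.log (1 / δ) / (α' - 1) = (1 - β') * ε := by
    intro hlog
    rw [hα', add_sub_cancel_right]
    field_simp
  have hDP : IsDP (Neighbouring (Ξ := 𝒮 × 𝒜 × 𝒮) (n := n)) (dptdCoinLaw d n T σsq)
      (fun S c => (dptdReleases A S c, dptdOutput A S c)) ε δ := by
    -- For `δ ≥ 1` the order `α'` is at most `1` and unusable, but privacy is trivial.
    rcases le_or_gt 1 δ with hδ1 | hδ1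
    · exact hA.isDP_of_one_le hn hT σsq ε hδ1
    have hlog : 0 < Real.log (1 / δ) := Real.log_pos (by rw [lt_div_iff₀ hδ]; linarith)
    have hα1 : 1 < α' := by
      rw [hα']
      linarith [div_pos hlog hβε]
    have hσ'0 : 0 < σsq' := by linarith
    have hσ0 : 0 < σsq := by
      rw [hσ'] at hσ'0
      exact (div_pos_iff_of_pos_right (by positivity)).1 hσ'0
    have hmul : σsq = σsq' * (4 * G ^ 2) := by rw [hσ']; field_simp
    -- The exponentiated form of the upper bound on `α'`. With `s = 1/σsq'` it is exactly the
    -- condition on `s` required by the mixture bound, and `σsq' ≥ 0.7` becomes `s ≤ 10/7`.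
    have hexp : Real.exp (1.5 * (α' - 1) * (1 / σsq')) ≤ n / (α' * (1 + σsq')) := by
      rw [← Real.le_log_iff_exp_le (by positivity)]
      rw [mul_one_div, div_le_iff₀ hσ'0]
      linarith
    have h := hA.isDP hn hT hσ0 hδ hα1 (s := 1 / σsq') (by positivity)
      (by rw [div_le_div_iff₀ hσ'0 (by norm_num)]; linarith)
      (by
        rw [le_div_iff₀ (by positivity)] at hexp
        have e : (1 / n : ℝ) * α' * (1 + 1 / σsq') * Real.exp (1.5 * (α' - 1) * (1 / σsq')) =
            Real.exp (1.5 * (α' - 1) * (1 / σsq')) * (α' * (1 + σsq')) / (n * σsq') := by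
          field_simp
          ring
        rw [e, div_le_div_iff₀ (by positivity) hσ'0]
        nlinarith)
      (by rw [hmul]; field_simp; exact le_rfl)
    have hε' : 3.5 * T * α' * (1 / σsq') / n ^ 2 + Real.log (1 / δ) / (α' - 1) = ε := by
      rw [hdiv hlog.ne']
      -- The constant `14` in the variance is `3.5 * 4`, with `4` from the squared sensitivity
      -- `4G²`.
      have : 3.5 * T * α' * (1 / σsq') / (n : ℝ) ^ 2 = β' * ε := by
        have hα0 : 0 < α' := by linarith
        have hT' : (0 : ℝ) < T := by exact_mod_cast hT
        rw [hσ', hσ]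
        field_simp
        norm_num
      rw [this]
      ring
    rw [hε'] at h
    exact h
  refine ⟨fun hδ1 => ?_, hDP.map measurable_snd, hDP⟩
  have hlog : Real.log (1 / δ) ≠ 0 := by
    rw [one_div, Real.log_inv]
    exact neg_ne_zero.2 (Real.log_ne_zero_of_pos_of_ne_one hδ hδ1)
  rw [hdiv hlog, hσ]
  ring_nf
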